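/- Let $\{X_{n,t}:1\le t\le n,\ n\in\mathbb N\}$ be a triangular array of random variables on a probability space $(\Omega,\mathcal A,P)$ with values in a measurable space $\mathcal X$, and let $\mathcal F$ be a class of measurable functions $\varphi:\mathcal X\to\mathbb R$ such that $\varphi(X_{n,t})$ is integrable for all $\varphi\in\mathcal F$ and $1\le t\le n$, $n\in\mathbb N$. For $t\ge 1$ put $$\alpha(t)=\sup_{n>t}\ \sup_{1\le k\le n-t}\ \sup\bigl\{|P(A\cap B)-P(A)P(B)|: A\in\sigma(X_{n,j}:1\le j\le k),\ B\in\sigma(X_{n,j}:k+t\le j\le n)\bigr\},$$ and for measurable $\varphi$ put $\rho(\varphi)=\sup_{n\in\mathbb N}\sup_{1\le t\le n}E[|\varphi(X_{n,t})|^2]^{1/2}\in[0,\infty]$. For $\varepsilon>0$ the bracketing number $N_{[\,]}(\varepsilon,\mathcal F,\rho)$ is the smallest integer $N$ for which there are a set $\mathcal A\subset\mathcal F$ (approximating class) and a set $\mathcal B$ of measurable functions $\mathcal X\to\mathbb R$ (bounding class) with $|\mathcal A|=|\mathcal B|=N$, with $\rho(b)<\varepsilon$ for all $b\in\mathcal B$,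 and such that for every $\varphi\in\mathcal F$ there are $a\in\mathcal A$ and $b\in\mathcal B$ with $|\varphi-a|\le b$ pointwise; it is $\infty$ if there is no such $N$. Let $Q\ge 2$ be an even integer and $\gamma>0$, and assume: (A1) The array is strongly mixing, i.e. $\alpha(t)\to0$ as $t\to\infty$, and $\sum_{t=1}^\infty t^{Q-2}\alpha(t)^{\gamma/(2+\gamma)}<\infty$. (A2) $\int_0^1 x^{-\gamma/(2+\gamma)}\,N_{[\,]}(x,\mathcal F,\rho)^{1/Q}\,dx<\infty$, and for every $\varepsilon>0$ the classes $\mathcal A,\mathcal B$ with $N_{[\,]}(\varepsilon,\mathcal F,\rho)$ elements in the definition of the bracketing number can be chosen such that for all $i=2,\dots,Q$ and all $b\in\mathcal B$ $$\sup_{n\in\mathbb N}\sup_{1\le t\le n}E\bigl[|b(X_{n,t})|^{i(2+\gamma)/2}\bigr]^{1/2}\le\varepsilon .$$ Let $G_n(s,\varphi)=n^{-1/2}\sum_{i=1}^{\lfloor ns\rfloor}\bigl(\varphi(X_{n,i})-E[\varphi(X_{n,i})]\bigr)$ for $s\in[0,1]$, and let $$d(\varphi,\psi)=\sup_{n\in\mathbb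 N}\sup_{1\le t\le n}E\bigl[|\varphi(X_{n,t})-\psi(X_{n,t})|^{Q(2+\gamma)/2}\bigr]^{\frac1Q\frac{2}{2+\gamma}}\in[0,\infty].$$ Then, with $E^*$ denoting outer expectation, $$\lim_{\delta\searrow0}\ \limsup_{n\to\infty}\ E^*\Bigl[\ \sup_{\varphi,\psi\in\mathcal F,\ d(\varphi,\psi)<\delta}|G_n(1,\varphi)-G_n(1,\psi)|^Q\Bigr]^{1/Q}=0 .$$ -/

import Mathlib

open MeasureTheory Filter Topology
open scoped ENNReal

noncomputable section

namespace EmpProc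

variable {Ω 𝒳 : Type*} [MeasurableSpace Ω] [MeasurableSpace 𝒳]

/-! A triangular array is a map `X : ℕ → ℕ → Ω → 𝒳`, of which only the entries `X n t` with
`1 ≤ t ≤ n` are ever used. -/

/-- The `σ`-algebra `σ(X_{n,j} : a ≤ j ≤ b)` generated by a block of the `n`-th row. -/
abbrev rowSigma (X : ℕ → ℕ → Ω → 𝒳) (n a b : ℕ) : MeasurableSpace Ω :=
  ⨆ j ∈ Finset.Icc a b, MeasurableSpace.comap (X n j) inferInstance

/-- The mixing coefficient `α_n(t)` of the `n`-th row. For `t ≥ n` there is no `k` with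
`1 ≤ k ≤ n - t`, so the supremum is `0`. -/
def alphaRow (μ : Measure Ω) (X : ℕ → ℕ → Ω → 𝒳) (n t : ℕ) : ℝ≥0∞ :=
  ⨆ k ∈ Finset.Icc 1 (n - t),
    ⨆ (A : Set Ω) (_ : MeasurableSet[rowSigma X n 1 k] A)
      (B : Set Ω) (_ : MeasurableSet[rowSigma X n (k + t) n] B),
      ENNReal.ofReal |μ.real (A ∩ B) - μ.real A * μ.real B|

/-- The mixing coefficient `α(t)` of the array. -/
def alpha (μ : Measure Ω) (X : ℕ → ℕ → Ω → 𝒳) (t : ℕ) : ℝ≥0∞ :=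
  if t = 0 then 1 else ⨆ n : ℕ, alphaRow μ X n t

/-- The array is strongly mixing (`α`-mixing). -/
def StronglyMixing (μ : Measure Ω) (X : ℕ → ℕ → Ω → 𝒳) : Prop :=
  Tendsto (alpha μ X) atTop (𝓝 0)

/-- `sup_n sup_{1 ≤ t ≤ n} E[|φ(X_{n,t})|^p]^r`, with values in `[0, ∞]`. -/
def supMoment (μ : Measure Ω) (X : ℕ → ℕ → Ω → 𝒳) (p r : ℝ) (φ : 𝒳 → ℝ) : ℝ≥0∞ :=
  ⨆ n : ℕ, ⨆ t ∈ Finset.Icc 1 n, (∫⁻ ω, ‖φ (X n t ω)‖ₑ ^ p ∂μ) ^ r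

/-- The seminorm `ρ(φ) = sup_n sup_{1 ≤ t ≤ n} E[|φ(X_{n,t})|^2]^{1/2}`. -/
def rho (μ : Measure Ω) (X : ℕ → ℕ → Ω → 𝒳) (φ : 𝒳 → ℝ) : ℝ≥0∞ :=
  supMoment μ X 2 (1 / 2) φ

/-- The semimetric
`d(φ,ψ) = sup_n sup_{1 ≤ t ≤ n} E[|φ(X_{n,t}) - ψ(X_{n,t})|^{Q(2+γ)/2}]^{(1/Q)(2/(2+γ))}`. -/
def dist (μ : Measure Ω) (X : ℕ → ℕ → Ω → 𝒳) (Q : ℕ) (γ : ℝ) (φ ψ : 𝒳 → ℝ) : ℝ≥0∞ :=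
  supMoment μ X (Q * ((2 + γ) / 2)) (1 / Q * (2 / (2 + γ))) (fun x => φ x - ψ x)

/-- `A` is an approximating class and `B` a bounding class for `F` at level `ε`, both with
exactly `N` elements. -/
def IsBracketing (ρ : (𝒳 → ℝ) → ℝ≥0∞) (F : Set (𝒳 → ℝ)) (ε : ℝ) (N : ℕ)
    (A B : Finset (𝒳 → ℝ)) : Prop :=
  A.card = N ∧ B.card = N ∧ (∀ a ∈ A, a ∈ F) ∧
    (∀ b ∈ B, Measurable b ∧ ρ b < ENNReal.ofReal ε) ∧
    ∀ φ ∈ F, ∃ a ∈ A, ∃ b ∈ B, ∀ x, |φ x - a x| ≤ b x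

/-- The bracketing number `N_[](ε, F, ρ)`; it is `⊤` if there are no finite classes as required. -/
def bracketingNumber (ρ : (𝒳 → ℝ) → ℝ≥0∞) (F : Set (𝒳 → ℝ)) (ε : ℝ) : ℕ∞ :=
  ⨅ (N : ℕ) (_ : ∃ A B : Finset (𝒳 → ℝ), IsBracketing ρ F ε N A B), (N : ℕ∞)

/-- The sequential empirical process
`G_n(s, φ) = n^{-1/2} ∑_{i=1}^{⌊ns⌋} (φ(X_{n,i}) - E[φ(X_{n,i})])`. -/
def empirical (μ : Measure Ω) (X : ℕ → ℕ → Ω → 𝒳) (n : ℕ) (s : ℝ) (φ : 𝒳 → ℝ)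
    (ω : Ω) : ℝ :=
  1 / √(n : ℝ) * ∑ i ∈ Finset.Icc 1 ⌊(n : ℝ) * s⌋₊, (φ (X n i ω) - ∫ ω', φ (X n i ω') ∂μ)

/-- The outer expectation `E^*[Z]` of a possibly non-measurable `Z : Ω → [0, ∞]`: the infimum of
`E[U]` over all measurable `U ≥ Z`. -/
def outerExpectation (μ : Measure Ω) (Z : Ω → ℝ≥0∞) : ℝ≥0∞ :=
  ⨅ (U : Ω → ℝ≥0∞) (_ : Measurable U) (_ : ∀ ω, Z ω ≤ U ω), ∫⁻ ω, U ω ∂μ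

end EmpProc

end

/-! The theorem combines a moment inequality of order `Q` with chaining along dyadic brackets.

The moment inequality (`exists_lintegral_empirical_le`) says that if all moments of order
`i(2+γ)/2`, `2 ≤ i ≤ Q`, of `f` along the array are at most `v^((2+γ)/2)` and `n v ≥ 1`, then the
`L^Q` norm of `G_n(1,f)` is at most `C v^(1/2)`. As `Q` is even, the `Q`-th power of the centred sum
expands into product moments over `Q`-tuples, which may be sorted. Each one is split at its largest
gap `r`. The covariance inequality `MixingLE.ofReal_abs_cov_le` makes the error a constant times `v
α(r)^(γ/(2+γ))`. At most a constant times `n (r+1)^(d-2)` monotone `d`-tuples have largest gap `r`,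
so the mixing series bounds the total error by `O(n v)`. The split products are handled by induction
on `d`, giving `(n v)^(d/2)`.

For the chaining, put `ε_k = 2^(-k)` and `v = ε_k^(4/(2+γ))`. A function below a level-`k` bounding
function then has norm at most `C ε_k^(2/(2+γ))`, and the maximum of `N` such variables costs a
factor `N^(1/Q)`. Summing over levels gives the tail of the series attached to the entropy integral.
The requirement `n v ≥ 1` stops the chain at `2^K ≈ n^((2+γ)/4)`, where the bias `√n ε_K` of the
last bracket is of order `n^(-γ/4)` and vanishes.

After chaining down to a fixed level `k₀`, at most `N_{k₀}^2` pairs remain. Each is represented by a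
pair of elements of `F` at `d`-distance below `δ`, so the moment inequality with `v = δ²` applies.
Letting `n → ∞`, then `δ → 0`, then `k₀ → ∞` finishes the proof. -/

noncomputable section

namespace EmpProc

/-! ### A covariance inequality for strongly mixing `σ`-algebras -/

/-- Lebesgue measure on the positive half line. -/
abbrev posVol : Measure ℝ := volume.restrict (Set.Ioi 0)

/-- The tail function `x ↦ μ(U > x)`. -/
def tail {Ω : Type*} [MeasurableSpace Ω] (μ : Measure Ω) (U : Ω → ℝ) (x : ℝ) : ℝ≥0∞ :=
  μ {ω | x < U ω}

/-- The upper quantile function of a nonnegative function, as the length of a superlevel set of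
its tail function. -/
def upperQuantile {Ω : Type*} [MeasurableSpace Ω] (μ : Measure Ω) (U : Ω → ℝ) (u : ℝ) : ℝ≥0∞ :=
  posVol {x | ENNReal.ofReal u < tail μ U x}

/-! ### Tail functions, quantile functions and layer-cake formulas. -/

section Quantile

variable {Ω : Type*} [MeasurableSpace Ω] {μ : Measure Ω} {U V : Ω → ℝ}

lemma antitone_tail : Antitone (tail μ U) := fun _ _ h =>
  measure_mono fun _ hω => lt_of_le_of_lt h hω

lemma measurableSet_lt_tail :
    MeasurableSet {z : ℝ × ℝ | ENNReal.ofReal z.1 < tail μ U z.2} :=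
  measurableSet_lt (ENNReal.measurable_ofReal.comp measurable_fst)
    (antitone_tail.measurable.comp measurable_snd)

lemma measurable_upperQuantile : Measurable (upperQuantile μ U) :=
  measurable_measure_prodMk_left measurableSet_lt_tail

lemma posVol_ofReal_lt (c : ℝ≥0∞) : posVol {u | ENNReal.ofReal u < c} = c := by
  rw [Measure.restrict_apply
    (measurableSet_lt ENNReal.measurable_ofReal measurable_const)]
  induction c with
  | top => simp
  | coe c =>
    have : {u : ℝ | ENNReal.ofReal u < (c : ℝ≥0∞)} ∩ Set.Ioi 0 = Set.Ioo 0 (c : ℝ) := by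
      ext u
      simp only [Set.mem_inter_iff, Set.mem_ofPred_eq, Set.mem_Ioi, Set.mem_Ioo]
      constructor
      · rintro ⟨h, hu⟩
        refine ⟨hu, ?_⟩
        rw [← ENNReal.ofReal_coe_nnreal] at h
        exact (ENNReal.ofReal_lt_ofReal_iff_of_nonneg hu.le).1 h
      · rintro ⟨hu, h⟩
        refine ⟨?_, hu⟩
        rw [← ENNReal.ofReal_coe_nnreal]
        exact (ENNReal.ofReal_lt_ofReal_iff_of_nonneg hu.le).2 h
    rw [this]
    simp

/-- The tail is antitone, so its superlevel sets are initial segments: one of length more than `x`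
must contain `x`. -/
lemma lt_tail_of_lt_upperQuantile {u x : ℝ}
    (h : ENNReal.ofReal x < upperQuantile μ U u) : ENNReal.ofReal u < tail μ U x := by
  by_contra! hc
  refine absurd h (not_lt.2 ?_)
  have hsub : {y | ENNReal.ofReal u < tail μ U y} ⊆ Set.Iio x := by
    intro y hy
    by_contra hxy
    exact absurd (lt_of_lt_of_le hy ((antitone_tail (not_lt.1 hxy)).trans hc)) (lt_irrefl _)
  calc upperQuantile μ U u ≤ posVol (Set.Iio x) := measure_mono hsub
    _ = ENNReal.ofReal x := by
      rw [Measure.restrict_apply measurableSet_Iio, Set.inter_comm, Set.Ioi_inter_Iio]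
      simp

/-- Markov's inequality: an infinite quantile at `u` would force `x * u ≤ E[U]` for every `x`. -/
lemma upperQuantile_lt_top (hU : Measurable U) (hfinite : ∫⁻ ω, ENNReal.ofReal (U ω) ∂μ ≠ ⊤)
    {u : ℝ} (hu : 0 < u) : upperQuantile μ U u < ⊤ := by
  set c := ∫⁻ ω, ENNReal.ofReal (U ω) ∂μ
  have hu' : ENNReal.ofReal u ≠ 0 := by simpa using hu
  by_contra hc
  have htop : upperQuantile μ U u = ⊤ := not_lt_top_iff.1 hc
  have key : ∀ x : ℝ, ENNReal.ofReal x * ENNReal.ofReal u ≤ c := fun x => by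
    have h1 : ENNReal.ofReal u < tail μ U x :=
      lt_tail_of_lt_upperQuantile (by rw [htop]; exact ENNReal.ofReal_lt_top)
    calc ENNReal.ofReal x * ENNReal.ofReal u
        ≤ ENNReal.ofReal x * μ {ω | ENNReal.ofReal x ≤ ENNReal.ofReal (U ω)} := by
          gcongr
          refine h1.le.trans (measure_mono fun ω hω => ?_)
          exact ENNReal.ofReal_le_ofReal (le_of_lt hω)
      _ ≤ c := mul_meas_ge_le_lintegral hU.ennreal_ofReal _
  have h2 := key ((c / ENNReal.ofReal u).toReal + 1)
  have h3 : c / ENNReal.ofReal u ≠ ⊤ := ENNReal.div_ne_top hfinite hu'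
  rw [ENNReal.ofReal_add ENNReal.toReal_nonneg zero_le_one, ENNReal.ofReal_toReal h3, add_mul,
    ENNReal.div_mul_cancel hu' ENNReal.ofReal_ne_top] at h2
  refine absurd h2 (not_le.2 (ENNReal.lt_add_right hfinite ?_))
  simpa using hu

/-- The quantile function exceeds `x` on a set of length at most `μ(U > x)`; the layer-cake formula
for `p`-th powers on both sides turns this into a comparison of moments. -/
lemma lintegral_upperQuantile_rpow_le (hU : Measurable U) (hU0 : 0 ≤ U)
    (hfinite : ∫⁻ ω, ENNReal.ofReal (U ω) ∂μ ≠ ⊤) {p : ℝ} (hp : 0 < p) :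
    ∫⁻ u, upperQuantile μ U u ^ p ∂posVol ≤ ∫⁻ ω, ENNReal.ofReal (U ω) ^ p ∂μ := by
  have h1 : ∫⁻ u, upperQuantile μ U u ^ p ∂posVol
      = ∫⁻ u, ENNReal.ofReal ((upperQuantile μ U u).toReal ^ p) ∂posVol := by
    refine setLIntegral_congr_fun measurableSet_Ioi fun u hu => ?_
    rw [← ENNReal.ofReal_rpow_of_nonneg ENNReal.toReal_nonneg hp.le,
      ENNReal.ofReal_toReal (upperQuantile_lt_top hU hfinite hu).ne]
  have h2 : ∫⁻ ω, ENNReal.ofReal (U ω) ^ p ∂μ = ∫⁻ ω, ENNReal.ofReal (U ω ^ p) ∂μ :=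
    lintegral_congr fun ω => ENNReal.ofReal_rpow_of_nonneg (hU0 ω) hp.le
  rw [h1, h2, lintegral_rpow_eq_lintegral_meas_lt_mul posVol
      (Eventually.of_forall fun _ => ENNReal.toReal_nonneg)
      measurable_upperQuantile.ennreal_toReal.aemeasurable hp,
    lintegral_rpow_eq_lintegral_meas_lt_mul μ (Eventually.of_forall hU0) hU.aemeasurable hp]
  gcongr ENNReal.ofReal p * ?_
  refine setLIntegral_mono' measurableSet_Ioi fun x hx => ?_
  gcongr
  calc posVol {u | x < (upperQuantile μ U u).toReal}
      ≤ posVol {u | ENNReal.ofReal u < tail μ U x} := by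
        refine measure_mono fun u hu => lt_tail_of_lt_upperQuantile ?_
        refine (ENNReal.ofReal_lt_iff_lt_toReal (le_of_lt hx) fun htop => ?_).2 hu
        simp only [Set.mem_ofPred_eq, htop, ENNReal.toReal_top] at hu
        exact lt_asymm hu hx
    _ = μ {ω | x < U ω} := posVol_ofReal_lt _

lemma lintegral_tail (hU : Measurable U) (hU0 : 0 ≤ U) :
    ∫⁻ x, tail μ U x ∂posVol = ∫⁻ ω, ENNReal.ofReal (U ω) ∂μ :=
  (lintegral_eq_lintegral_meas_lt μ (Eventually.of_forall hU0) hU.aemeasurable).symm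

/-- The minimum is the length of `{u > 0 : u < a, u < P(U > x), u < P(V > y)}`, hence the integral
over `u` of a product of three indicators. By Tonelli the double integral becomes the integral over
`0 < u < a` of the product of the two quantile functions, and Hölder with three factors concludes.
-/
lemma lintegral_min_tail_le (hU : Measurable U) (hU0 : 0 ≤ U)
    (hUint : ∫⁻ ω, ENNReal.ofReal (U ω) ∂μ ≠ ⊤) (hV : Measurable V) (hV0 : 0 ≤ V)
    (hVint : ∫⁻ ω, ENNReal.ofReal (V ω) ∂μ ≠ ⊤) (a : ℝ≥0∞) {θ p q : ℝ} (hθ : 0 < θ)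
    (hp : 0 < p) (hq : 0 < q) (hsum : θ + 1 / p + 1 / q = 1) :
    ∫⁻ z, min a (min (tail μ U z.1) (tail μ V z.2)) ∂(posVol.prod posVol) ≤
      a ^ θ * (∫⁻ ω, ENNReal.ofReal (U ω) ^ p ∂μ) ^ (1 / p) *
        (∫⁻ ω, ENNReal.ofReal (V ω) ^ q ∂μ) ^ (1 / q) := by
  set I : ℝ → ℝ≥0∞ := {u | ENNReal.ofReal u < a}.indicator 1 with hI
  have hIm : Measurable I :=
    measurable_one.indicator (measurableSet_lt ENNReal.measurable_ofReal measurable_const)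
  have hUm := measurableSet_lt_tail (μ := μ) (U := U)
  have hVm := measurableSet_lt_tail (μ := μ) (U := V)
  set JU : ℝ → ℝ → ℝ≥0∞ := fun u x => {z : ℝ × ℝ | ENNReal.ofReal z.1 < tail μ U z.2}.indicator 1
    (u, x) with hJU
  set JV : ℝ → ℝ → ℝ≥0∞ := fun u x => {z : ℝ × ℝ | ENNReal.ofReal z.1 < tail μ V z.2}.indicator 1
    (u, x) with hJV
  have hJUm : Measurable fun z : ℝ × ℝ => JU z.1 z.2 := measurable_one.indicator hUm
  have hJVm : Measurable fun z : ℝ × ℝ => JV z.1 z.2 := measurable_one.indicator hVm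
  have hq1 : ∀ u, ∫⁻ x, JU u x ∂posVol = upperQuantile μ U u := fun u =>
    lintegral_indicator_one (measurable_prodMk_left hUm)
  have hq2 : ∀ u, ∫⁻ x, JV u x ∂posVol = upperQuantile μ V u := fun u =>
    lintegral_indicator_one (measurable_prodMk_left hVm)
  have h1 : ∀ z : ℝ × ℝ, min a (min (tail μ U z.1) (tail μ V z.2)) =
      ∫⁻ u, I u * (JU u z.1 * JV u z.2) ∂posVol := fun z => by
    rw [← posVol_ofReal_lt (min a _), ← lintegral_indicator_one
      (measurableSet_lt ENNReal.measurable_ofReal measurable_const)]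
    refine lintegral_congr fun u => ?_
    simp only [hI, hJU, hJV, Set.indicator_apply, Set.mem_ofPred_eq, lt_min_iff, Pi.one_apply]
    by_cases h1 : ENNReal.ofReal u < a <;> by_cases h2 : ENNReal.ofReal u < tail μ U z.1 <;>
      by_cases h3 : ENNReal.ofReal u < tail μ V z.2 <;> simp [h1, h2, h3]
  have h2 : ∫⁻ z, min a (min (tail μ U z.1) (tail μ V z.2)) ∂(posVol.prod posVol) =
      ∫⁻ u, I u * (upperQuantile μ U u * upperQuantile μ V u) ∂posVol := by
    rw [lintegral_congr h1, lintegral_lintegral_swap]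
    · refine lintegral_congr fun u => ?_
      rw [lintegral_const_mul, lintegral_prod_mul, hq1, hq2]
      · exact (hJUm.comp measurable_prodMk_left).aemeasurable
      · exact (hJVm.comp measurable_prodMk_left).aemeasurable
      · exact ((hJUm.comp measurable_prodMk_left).comp measurable_fst).mul
          ((hJVm.comp measurable_prodMk_left).comp measurable_snd)
    · refine Measurable.aemeasurable ?_
      refine (hIm.comp measurable_snd).mul (Measurable.mul ?_ ?_)
      · exact hJUm.comp (measurable_snd.prodMk measurable_fst.fst)
      · exact hJVm.comp (measurable_snd.prodMk measurable_fst.snd)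
  rw [h2]
  have hH := ENNReal.lintegral_prod_norm_pow_le (μ := posVol) (Finset.univ : Finset (Fin 3))
    (f := ![I, fun u => upperQuantile μ U u ^ p, fun u => upperQuantile μ V u ^ q])
    (by
      intro i _
      fin_cases i
      · exact hIm.aemeasurable
      · exact (measurable_upperQuantile.pow_const p).aemeasurable
      · exact (measurable_upperQuantile.pow_const q).aemeasurable)
    (p := ![θ, 1 / p, 1 / q]) (by simpa [Fin.sum_univ_three] using hsum)
    (by intro i _; fin_cases i <;> simp <;> positivity)
  simp only [Fin.prod_univ_three, Matrix.cons_val_zero, Matrix.cons_val_one,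
    Matrix.cons_val] at hH
  have hIθ : ∀ u, I u ^ θ = I u := fun u => by
    simp only [hI, Set.indicator_apply]
    split_ifs
    · simp
    · simp [hθ]
  have hIint : ∫⁻ u, I u ∂posVol = a := by
    rw [lintegral_indicator_one (measurableSet_lt ENNReal.measurable_ofReal measurable_const),
      posVol_ofReal_lt]
  rw [hIint] at hH
  calc _ = ∫⁻ u, I u ^ θ * (upperQuantile μ U u ^ p) ^ (1 / p) *
        (upperQuantile μ V u ^ q) ^ (1 / q) ∂posVol := by
        refine lintegral_congr fun u => ?_
        rw [hIθ, ← ENNReal.rpow_mul, ← ENNReal.rpow_mul, mul_one_div_cancel hp.ne',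
          mul_one_div_cancel hq.ne', ENNReal.rpow_one, ENNReal.rpow_one, mul_assoc]
    _ ≤ _ := hH
    _ ≤ _ := by
        gcongr
        · exact lintegral_upperQuantile_rpow_le hU hU0 hUint hp
        · exact lintegral_upperQuantile_rpow_le hV hV0 hVint hq

lemma lintegral_mul_eq_lintegral_prod [SFinite μ] (hU : Measurable U) (hV : Measurable V) :
    ∫⁻ ω, ENNReal.ofReal (U ω) * ENNReal.ofReal (V ω) ∂μ =
      ∫⁻ z, μ ({ω | z.1 < U ω} ∩ {ω | z.2 < V ω}) ∂(posVol.prod posVol) := by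
  have hJ : ∀ W : Ω → ℝ, ∀ ω, ENNReal.ofReal (W ω) =
      ∫⁻ x, {y | y < W ω}.indicator 1 x ∂posVol := fun W ω => by
    change _ = ∫⁻ x, (Set.Iio (W ω)).indicator 1 x ∂posVol
    rw [lintegral_indicator_one measurableSet_Iio, Measure.restrict_apply measurableSet_Iio,
      Set.inter_comm, Set.Ioi_inter_Iio]
    simp
  have h1 : ∀ ω, ENNReal.ofReal (U ω) * ENNReal.ofReal (V ω) =
      ∫⁻ z : ℝ × ℝ, {y | y < U ω}.indicator 1 z.1 * {y | y < V ω}.indicator 1 z.2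
        ∂(posVol.prod posVol) := fun ω => by
    rw [hJ U, hJ V, lintegral_prod_mul]
    · exact (measurable_one.indicator measurableSet_Iio).aemeasurable
    · exact (measurable_one.indicator measurableSet_Iio).aemeasurable
  have h2 : ∀ ω (z : ℝ × ℝ), ({y | y < U ω}.indicator 1 z.1 * {y | y < V ω}.indicator 1 z.2 : ℝ≥0∞)
      = ({y : Ω × ℝ × ℝ | y.2.1 < U y.1} ∩ {y : Ω × ℝ × ℝ | y.2.2 < V y.1}).indicator 1 (ω, z) := by
    intro ω z
    by_cases h1 : z.1 < U ω <;> by_cases h2 : z.2 < V ω <;> simp [h1, h2]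
  have hm : MeasurableSet ({y : Ω × ℝ × ℝ | y.2.1 < U y.1} ∩ {y : Ω × ℝ × ℝ | y.2.2 < V y.1}) :=
    (measurableSet_lt measurable_snd.fst (hU.comp measurable_fst)).inter
      (measurableSet_lt measurable_snd.snd (hV.comp measurable_fst))
  simp_rw [h1, h2]
  rw [lintegral_lintegral_swap]
  · refine lintegral_congr fun z => ?_
    exact lintegral_indicator_one (measurable_prodMk_right hm)
  · exact (measurable_one.indicator hm).aemeasurable

end Quantile

/-- The `σ`-algebras `m₁` and `m₂` are strongly mixing with coefficient at most `a`. -/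
def MixingLE {Ω : Type*} [MeasurableSpace Ω] (μ : Measure Ω) (m₁ m₂ : MeasurableSpace Ω)
    (a : ℝ≥0∞) : Prop :=
  ∀ A B, MeasurableSet[m₁] A → MeasurableSet[m₂] B →
    ENNReal.ofReal |μ.real (A ∩ B) - μ.real A * μ.real B| ≤ a

/-! ### From mixing of events to covariances of functions. -/

section Covariance

variable {Ω : Type*} {m₁ m₂ : MeasurableSpace Ω} [mΩ : MeasurableSpace Ω] {μ : Measure Ω}
  [IsProbabilityMeasure μ] {a : ℝ≥0∞}

/-- Covers gap zero, that is, repeated entries in a tuple, where `alpha` has the value `1`. -/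
lemma mixingLE_one : MixingLE μ m₁ m₂ 1 := fun A B _ _ => by
  rw [← ENNReal.ofReal_one]
  refine ENNReal.ofReal_le_ofReal (abs_le.2 ⟨?_, ?_⟩)
  · nlinarith [measureReal_le_one (μ := μ) (s := A), measureReal_le_one (μ := μ) (s := B),
      measureReal_nonneg (μ := μ) (s := A), measureReal_nonneg (μ := μ) (s := B),
      measureReal_nonneg (μ := μ) (s := A ∩ B)]
  · nlinarith [measureReal_le_one (μ := μ) (s := A ∩ B), measureReal_nonneg (μ := μ) (s := A),
      measureReal_nonneg (μ := μ) (s := B)]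

lemma MixingLE.ofReal_abs_sub_le_min (h : MixingLE μ m₁ m₂ a) {A B : Set Ω}
    (hA : MeasurableSet[m₁] A) (hB : MeasurableSet[m₂] B) :
    ENNReal.ofReal |μ.real (A ∩ B) - μ.real A * μ.real B| ≤ min a (min (μ A) (μ B)) := by
  have hA1 := measureReal_le_one (μ := μ) (s := A)
  have hB1 := measureReal_le_one (μ := μ) (s := B)
  have hA0 := measureReal_nonneg (μ := μ) (s := A)
  have hB0 := measureReal_nonneg (μ := μ) (s := B)
  have h0 := measureReal_nonneg (μ := μ) (s := A ∩ B)
  have hAB : μ.real (A ∩ B) ≤ μ.real A := measureReal_mono Set.inter_subset_left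
  have hBA : μ.real (A ∩ B) ≤ μ.real B := measureReal_mono Set.inter_subset_right
  refine le_min (h A B hA hB) (le_min ?_ ?_)
  · rw [← ofReal_measureReal]
    exact ENNReal.ofReal_le_ofReal (abs_le.2 ⟨by nlinarith, by nlinarith⟩)
  · rw [← ofReal_measureReal]
    exact ENNReal.ofReal_le_ofReal (abs_le.2 ⟨by nlinarith, by nlinarith⟩)

lemma MixingLE.measure_inter_le (h : MixingLE μ m₁ m₂ a) {A B : Set Ω}
    (hA : MeasurableSet[m₁] A) (hB : MeasurableSet[m₂] B) :
    μ (A ∩ B) ≤ μ A * μ B + min a (min (μ A) (μ B)) := by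
  refine le_trans ?_ (add_le_add_right (h.ofReal_abs_sub_le_min hA hB) _)
  rw [← ofReal_measureReal (μ := μ) (s := A), ← ofReal_measureReal (μ := μ) (s := B),
    ← ofReal_measureReal (μ := μ) (s := A ∩ B), ← ENNReal.ofReal_mul measureReal_nonneg,
    ← ENNReal.ofReal_add (mul_nonneg measureReal_nonneg measureReal_nonneg) (abs_nonneg _)]
  exact ENNReal.ofReal_le_ofReal (by linarith [le_abs_self (μ.real (A ∩ B) - μ.real A * μ.real B)])

lemma MixingLE.mul_measure_le (h : MixingLE μ m₁ m₂ a) {A B : Set Ω}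
    (hA : MeasurableSet[m₁] A) (hB : MeasurableSet[m₂] B) :
    μ A * μ B ≤ μ (A ∩ B) + min a (min (μ A) (μ B)) := by
  refine le_trans ?_ (add_le_add_right (h.ofReal_abs_sub_le_min hA hB) _)
  rw [← ofReal_measureReal (μ := μ) (s := A), ← ofReal_measureReal (μ := μ) (s := B),
    ← ofReal_measureReal (μ := μ) (s := A ∩ B), ← ENNReal.ofReal_mul measureReal_nonneg,
    ← ENNReal.ofReal_add measureReal_nonneg (abs_nonneg _)]
  exact ENNReal.ofReal_le_ofReal
    (by linarith [neg_abs_le (μ.real (A ∩ B) - μ.real A * μ.real B)])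

/-- Covariance inequality for nonnegative functions. -/
lemma MixingLE.ofReal_abs_cov_le_of_nonneg (h : MixingLE μ m₁ m₂ a) (h₁ : m₁ ≤ mΩ) (h₂ : m₂ ≤ mΩ)
    {U V : Ω → ℝ} (hU : Measurable[m₁] U) (hV : Measurable[m₂] V) (hU0 : 0 ≤ U) (hV0 : 0 ≤ V)
    (hUint : Integrable U μ) (hVint : Integrable V μ) (hUV : Integrable (fun ω => U ω * V ω) μ)
    {θ p q : ℝ} (hθ : 0 < θ) (hp : 0 < p) (hq : 0 < q) (hsum : θ + 1 / p + 1 / q = 1) :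
    ENNReal.ofReal |∫ ω, U ω * V ω ∂μ - (∫ ω, U ω ∂μ) * ∫ ω, V ω ∂μ| ≤
      a ^ θ * (∫⁻ ω, ‖U ω‖ₑ ^ p ∂μ) ^ (1 / p) * (∫⁻ ω, ‖V ω‖ₑ ^ q ∂μ) ^ (1 / q) := by
  have hU' : Measurable U := hU.mono h₁ le_rfl
  have hV' : Measurable V := hV.mono h₂ le_rfl
  have hUl := ofReal_integral_eq_lintegral_ofReal hUint (Eventually.of_forall hU0)
  have hVl := ofReal_integral_eq_lintegral_ofReal hVint (Eventually.of_forall hV0)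
  have hUVl := ofReal_integral_eq_lintegral_ofReal hUV
    (Eventually.of_forall fun ω => mul_nonneg (hU0 ω) (hV0 ω))
  have hmul : ∀ ω, ENNReal.ofReal (U ω * V ω) = ENNReal.ofReal (U ω) * ENNReal.ofReal (V ω) :=
    fun ω => ENNReal.ofReal_mul (hU0 ω)
  simp_rw [hmul] at hUVl
  have hUfin : ∫⁻ ω, ENNReal.ofReal (U ω) ∂μ ≠ ⊤ := by rw [← hUl]; exact ENNReal.ofReal_ne_top
  have hVfin : ∫⁻ ω, ENNReal.ofReal (V ω) ∂μ ≠ ⊤ := by rw [← hVl]; exact ENNReal.ofReal_ne_top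
  have hmin := lintegral_min_tail_le (μ := μ) hU' hU0 hUfin hV' hV0 hVfin a hθ hp hq hsum
  simp_rw [Real.enorm_of_nonneg (hU0 _), Real.enorm_of_nonneg (hV0 _)]
  set R := a ^ θ * (∫⁻ ω, ENNReal.ofReal (U ω) ^ p ∂μ) ^ (1 / p) *
    (∫⁻ ω, ENNReal.ofReal (V ω) ^ q ∂μ) ^ (1 / q)
  have hprod : ENNReal.ofReal (∫ ω, U ω ∂μ) * ENNReal.ofReal (∫ ω, V ω ∂μ) =
      ∫⁻ z, tail μ U z.1 * tail μ V z.2 ∂(posVol.prod posVol) := by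
    rw [lintegral_prod_mul antitone_tail.measurable.aemeasurable
      antitone_tail.measurable.aemeasurable, lintegral_tail hU' hU0, lintegral_tail hV' hV0,
      hUl, hVl]
  have hA : ∀ x, MeasurableSet[m₁] {ω | x < U ω} := fun _ => hU measurableSet_Ioi
  have hB : ∀ x, MeasurableSet[m₂] {ω | x < V ω} := fun _ => hV measurableSet_Ioi
  have hminm : Measurable fun z : ℝ × ℝ => min a (min (tail μ U z.1) (tail μ V z.2)) :=
    measurable_const.min ((antitone_tail.measurable.comp measurable_fst).min
      (antitone_tail.measurable.comp measurable_snd))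
  have up : ENNReal.ofReal (∫ ω, U ω * V ω ∂μ) ≤
      ENNReal.ofReal (∫ ω, U ω ∂μ) * ENNReal.ofReal (∫ ω, V ω ∂μ) + R := by
    rw [hUVl, lintegral_mul_eq_lintegral_prod hU' hV', hprod]
    refine le_trans ?_ (add_le_add_right hmin _)
    rw [← lintegral_add_right _ hminm]
    exact lintegral_mono fun z => h.measure_inter_le (hA z.1) (hB z.2)
  have down : ENNReal.ofReal (∫ ω, U ω ∂μ) * ENNReal.ofReal (∫ ω, V ω ∂μ) ≤
      ENNReal.ofReal (∫ ω, U ω * V ω ∂μ) + R := by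
    rw [hUVl, lintegral_mul_eq_lintegral_prod hU' hV', hprod]
    refine le_trans ?_ (add_le_add_right hmin _)
    rw [← lintegral_add_right _ hminm]
    exact lintegral_mono fun z => h.mul_measure_le (hA z.1) (hB z.2)
  have hU0' : 0 ≤ ∫ ω, U ω ∂μ := integral_nonneg hU0
  have hV0' : 0 ≤ ∫ ω, V ω ∂μ := integral_nonneg hV0
  rw [← ENNReal.ofReal_mul hU0'] at up down
  rcases le_total 0 (∫ ω, U ω * V ω ∂μ - (∫ ω, U ω ∂μ) * ∫ ω, V ω ∂μ) with hs | hs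
  · rw [abs_of_nonneg hs, ENNReal.ofReal_sub _ (mul_nonneg hU0' hV0')]
    exact tsub_le_iff_left.2 up
  · rw [abs_of_nonpos hs, neg_sub, ENNReal.ofReal_sub _
      (integral_nonneg fun ω => mul_nonneg (hU0 ω) (hV0 ω))]
    exact tsub_le_iff_left.2 down

/-- Covariance inequality for strongly mixing `σ`-algebras. -/
lemma MixingLE.ofReal_abs_cov_le (h : MixingLE μ m₁ m₂ a) (h₁ : m₁ ≤ mΩ) (h₂ : m₂ ≤ mΩ)
    {U V : Ω → ℝ} (hU : Measurable[m₁] U) (hV : Measurable[m₂] V)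
    (hUint : Integrable U μ) (hVint : Integrable V μ) (hUV : Integrable (fun ω => U ω * V ω) μ)
    {θ p q : ℝ} (hθ : 0 < θ) (hp : 0 < p) (hq : 0 < q) (hsum : θ + 1 / p + 1 / q = 1) :
    ENNReal.ofReal |∫ ω, U ω * V ω ∂μ - (∫ ω, U ω ∂μ) * ∫ ω, V ω ∂μ| ≤
      4 * (a ^ θ * (∫⁻ ω, ‖U ω‖ₑ ^ p ∂μ) ^ (1 / p) * (∫⁻ ω, ‖V ω‖ₑ ^ q ∂μ) ^ (1 / q)) := by
  set R := a ^ θ * (∫⁻ ω, ‖U ω‖ₑ ^ p ∂μ) ^ (1 / p) * (∫⁻ ω, ‖V ω‖ₑ ^ q ∂μ) ^ (1 / q) with hR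
  have hmax : ∀ {m : MeasurableSpace Ω}, ∀ {W : Ω → ℝ}, Measurable W →
      Measurable fun ω => max (W ω) 0 := fun hW => hW.max measurable_const
  have key : ∀ U' V' : Ω → ℝ, Measurable[m₁] U' → Measurable[m₂] V' → 0 ≤ U' → 0 ≤ V' →
      (∀ ω, U' ω ≤ |U ω|) → (∀ ω, V' ω ≤ |V ω|) →
      Integrable U' μ ∧ Integrable V' μ ∧ Integrable (fun ω => U' ω * V' ω) μ ∧
      ENNReal.ofReal |∫ ω, U' ω * V' ω ∂μ - (∫ ω, U' ω ∂μ) * ∫ ω, V' ω ∂μ| ≤ R := by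
    intro U' V' hU' hV' hU0 hV0 hUle hVle
    have hmU : Measurable U' := hU'.mono h₁ le_rfl
    have hmV : Measurable V' := hV'.mono h₂ le_rfl
    have i1 : Integrable U' μ := hUint.mono hmU.aestronglyMeasurable (Eventually.of_forall fun ω =>
      by rw [Real.norm_of_nonneg (hU0 ω)]; exact hUle ω)
    have i2 : Integrable V' μ := hVint.mono hmV.aestronglyMeasurable (Eventually.of_forall fun ω =>
      by rw [Real.norm_of_nonneg (hV0 ω)]; exact hVle ω)
    have i3 : Integrable (fun ω => U' ω * V' ω) μ :=
      hUV.mono (hmU.mul hmV).aestronglyMeasurable (Eventually.of_forall fun ω => by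
        rw [Real.norm_of_nonneg (mul_nonneg (hU0 ω) (hV0 ω)), Real.norm_eq_abs, abs_mul]
        exact mul_le_mul (hUle ω) (hVle ω) (hV0 ω) (abs_nonneg _))
    refine ⟨i1, i2, i3, (h.ofReal_abs_cov_le_of_nonneg h₁ h₂ hU' hV' hU0 hV0 i1 i2 i3 hθ hp hq
      hsum).trans ?_⟩
    rw [hR]
    gcongr with ω ω
    · rw [Real.enorm_of_nonneg (hU0 ω), Real.enorm_eq_ofReal_abs]
      exact ENNReal.ofReal_le_ofReal (hUle ω)
    · rw [Real.enorm_of_nonneg (hV0 ω), Real.enorm_eq_ofReal_abs]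
      exact ENNReal.ofReal_le_ofReal (hVle ω)
  have pos : ∀ {W : Ω → ℝ}, 0 ≤ fun ω => max (W ω) 0 := fun ω => le_max_right _ _
  have le1 : ∀ x : ℝ, max x 0 ≤ |x| := fun x => max_le (le_abs_self x) (abs_nonneg x)
  have le2 : ∀ x : ℝ, max (-x) 0 ≤ |x| := fun x => max_le (neg_le_abs x) (abs_nonneg x)
  -- Positive and negative parts of both functions give four covariances, whence the factor 4.
  obtain ⟨i1, j1, k1, b1⟩ := key _ _ (hmax hU) (hmax hV) pos pos (fun _ => le1 _) fun _ => le1 _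
  obtain ⟨-, j2, k2, b2⟩ := key _ _ (hmax hU) (hmax hV.neg) pos pos (fun _ => le1 _)
    fun _ => le2 _
  obtain ⟨i2, -, k3, b3⟩ := key _ _ (hmax hU.neg) (hmax hV) pos pos (fun _ => le2 _)
    fun _ => le1 _
  obtain ⟨-, -, k4, b4⟩ := key _ _ (hmax hU.neg) (hmax hV.neg) pos pos (fun _ => le2 _)
    fun _ => le2 _
  simp only [Pi.neg_apply] at i2 j2 k2 k3 k4 b2 b3 b4
  have hd : ∀ x : ℝ, x = max x 0 - max (-x) 0 := fun x => by
    rcases le_total 0 x with hx | hx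
    · rw [max_eq_left hx, max_eq_right (by linarith)]; ring
    · rw [max_eq_right hx, max_eq_left (by linarith)]; ring
  have eU : ∫ ω, U ω ∂μ = ∫ ω, max (U ω) 0 ∂μ - ∫ ω, max (-U ω) 0 ∂μ := by
    rw [← integral_sub i1 i2]; exact integral_congr_ae (Eventually.of_forall fun ω => hd _)
  have eV : ∫ ω, V ω ∂μ = ∫ ω, max (V ω) 0 ∂μ - ∫ ω, max (-V ω) 0 ∂μ := by
    rw [← integral_sub j1 j2]; exact integral_congr_ae (Eventually.of_forall fun ω => hd _)
  have eUV : ∫ ω, U ω * V ω ∂μ = (∫ ω, max (U ω) 0 * max (V ω) 0 ∂μ -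
      ∫ ω, max (U ω) 0 * max (-V ω) 0 ∂μ) - (∫ ω, max (-U ω) 0 * max (V ω) 0 ∂μ -
      ∫ ω, max (-U ω) 0 * max (-V ω) 0 ∂μ) := by
    rw [← integral_sub k1 k2, ← integral_sub k3 k4]
    refine Eq.trans ?_ (integral_sub (k1.sub k2) (k3.sub k4))
    refine integral_congr_ae (Eventually.of_forall fun ω => ?_)
    simp only
    conv_lhs => rw [hd (U ω), hd (V ω)]
    ring
  rw [eU, eV, eUV]
  set x1 := ∫ ω, max (U ω) 0 ∂μ
  set x2 := ∫ ω, max (-U ω) 0 ∂μ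
  set y1 := ∫ ω, max (V ω) 0 ∂μ
  set y2 := ∫ ω, max (-V ω) 0 ∂μ
  set z1 := ∫ ω, max (U ω) 0 * max (V ω) 0 ∂μ
  set z2 := ∫ ω, max (U ω) 0 * max (-V ω) 0 ∂μ
  set z3 := ∫ ω, max (-U ω) 0 * max (V ω) 0 ∂μ
  set z4 := ∫ ω, max (-U ω) 0 * max (-V ω) 0 ∂μ
  have tri : |z1 - z2 - (z3 - z4) - (x1 - x2) * (y1 - y2)| ≤
      |z1 - x1 * y1| + |z2 - x1 * y2| + |z3 - x2 * y1| + |z4 - x2 * y2| := by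
    have : z1 - z2 - (z3 - z4) - (x1 - x2) * (y1 - y2) =
        (z1 - x1 * y1) - (z2 - x1 * y2) - (z3 - x2 * y1) + (z4 - x2 * y2) := by ring
    rw [this]
    refine (abs_add_le _ _).trans (add_le_add_left ?_ _)
    refine (abs_sub _ _).trans (add_le_add_left ?_ _)
    exact abs_sub _ _
  refine (ENNReal.ofReal_le_ofReal tri).trans ?_
  rw [ENNReal.ofReal_add (by positivity) (by positivity),
    ENNReal.ofReal_add (by positivity) (by positivity),
    ENNReal.ofReal_add (by positivity) (by positivity)]
  calc _ ≤ R + R + R + R := by gcongr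
    _ = 4 * R := by ring

end Covariance

/-! ### Sums over monotone tuples -/

lemma sum_comp_le_of_injOn {α β : Type*} {s : Finset α} {t : Finset β}
    {φ : α → β} (hmaps : ∀ x ∈ s, φ x ∈ t) (hinj : Set.InjOn φ s) (h : β → ℝ≥0∞) :
    ∑ x ∈ s, h (φ x) ≤ ∑ y ∈ t, h y := by
  classical
  rw [← Finset.sum_image hinj]
  exact Finset.sum_le_sum_of_subset fun y hy => by
    obtain ⟨x, hx, rfl⟩ := Finset.mem_image.1 hy
    exact hmaps x hx

open Classical in
/-- The monotone `d`-tuples with entries in `{1, …, n}`. -/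
def monoTuples (n d : ℕ) : Finset (Fin d → ℕ) :=
  (Fintype.piFinset fun _ => Finset.Icc 1 n).filter Monotone

lemma mem_monoTuples {n d : ℕ} {t : Fin d → ℕ} :
    t ∈ monoTuples n d ↔ (∀ i, t i ∈ Finset.Icc 1 n) ∧ Monotone t := by
  simp [monoTuples, Fintype.mem_piFinset]

/-- The first `m` entries of a tuple. -/
def takeTuple {d : ℕ} (m : ℕ) (h : m ≤ d) (t : Fin d → ℕ) : Fin m → ℕ :=
  fun i => t ⟨i, i.2.trans_le h⟩

/-- The entries of a tuple after the first `m`. -/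
def dropTuple {d : ℕ} (m : ℕ) (t : Fin d → ℕ) : Fin (d - m) → ℕ :=
  fun i => t ⟨m + i, by omega⟩

lemma takeTuple_mem {n d m : ℕ} (h : m ≤ d) {t : Fin d → ℕ} (ht : t ∈ monoTuples n d) :
    takeTuple m h t ∈ monoTuples n m := by
  rw [mem_monoTuples] at ht ⊢
  exact ⟨fun i => ht.1 _, fun i j hij => ht.2 hij⟩

lemma dropTuple_mem {n d m : ℕ} {t : Fin d → ℕ} (ht : t ∈ monoTuples n d) :
    dropTuple m t ∈ monoTuples n (d - m) := by
  rw [mem_monoTuples] at ht ⊢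
  refine ⟨fun i => ht.1 _, fun i j hij => ht.2 ?_⟩
  simpa using hij

/-- Cutting a tuple in two is injective, so the left side is a subsum of the expanded product. -/
lemma sum_take_mul_drop_le {n d m : ℕ} (h : m ≤ d) (F : (Fin m → ℕ) → ℝ≥0∞)
    (G : (Fin (d - m) → ℕ) → ℝ≥0∞) :
    ∑ t ∈ monoTuples n d, F (takeTuple m h t) * G (dropTuple m t) ≤
      (∑ t ∈ monoTuples n m, F t) * ∑ t ∈ monoTuples n (d - m), G t := by
  rw [Finset.sum_mul_sum, ← Finset.sum_product']
  refine sum_comp_le_of_injOn (φ := fun t => (takeTuple m h t, dropTuple m t))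
    (h := fun p => F p.1 * G p.2) (fun t ht => ?_) fun t _ t' _ htt => ?_
  · exact Finset.mem_product.2 ⟨takeTuple_mem h ht, dropTuple_mem ht⟩
  · obtain ⟨h1, h2⟩ := Prod.mk.inj htt
    funext i
    rcases lt_or_ge (i : ℕ) m with hi | hi
    · exact congrFun h1 ⟨i, hi⟩
    · have := congrFun h2 ⟨i - m, by omega⟩
      simp only [dropTuple] at this
      convert this using 2 <;> ext <;> simp <;> omega

/-- The consecutive differences of a tuple. -/
def tupleGaps {k : ℕ} (t : Fin (k + 1) → ℕ) : Fin k → ℕ := fun i => t i.succ - t i.castSucc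

/-- A monotone tuple is determined by its first entry, with `n` possible values, and its gaps;
monotonicity makes the truncated subtraction harmless. -/
lemma sum_comp_tupleGaps_le {n k : ℕ} (h : (Fin k → ℕ) → ℝ≥0∞) :
    ∑ t ∈ monoTuples n (k + 1), h (tupleGaps t) ≤ n * ∑' g, h g := by
  classical
  set J : Finset (Fin k → ℕ) := (monoTuples n (k + 1)).image tupleGaps
  have hle : ∑ t ∈ monoTuples n (k + 1), h (tupleGaps t) ≤
      ∑ p ∈ (Finset.Icc 1 n) ×ˢ J, h p.2 := by
    refine sum_comp_le_of_injOn (t := (Finset.Icc 1 n) ×ˢ J)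
      (φ := fun t : Fin (k + 1) → ℕ => (t 0, tupleGaps t)) (h := fun p => h p.2)
      (fun t ht => Finset.mem_product.2 ⟨(mem_monoTuples.1 ht).1 0,
        Finset.mem_image_of_mem _ ht⟩) fun t ht t' ht' htt => ?_
    obtain ⟨h1, h2⟩ := Prod.mk.inj htt
    funext i
    induction i using Fin.induction with
    | zero => exact h1
    | succ i ih =>
      have h3 : t i.succ - t i.castSucc = t' i.succ - t' i.castSucc := congrFun h2 i
      have h4 := (mem_monoTuples.1 ht).2 (Fin.castSucc_lt_succ (i := i)).le
      have h5 := (mem_monoTuples.1 ht').2 (Fin.castSucc_lt_succ (i := i)).le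
      omega
  refine hle.trans ?_
  rw [Finset.sum_product]
  dsimp only
  rw [Finset.sum_const, Nat.card_Icc, Nat.add_sub_cancel, nsmul_eq_mul]
  gcongr
  exact ENNReal.sum_le_tsum _

/-- A gap vector with maximum `r` attained at `m` has the other `k - 1` coordinates in `{0, …, r}`.
-/
lemma tsum_comp_sup_le {k : ℕ} (hk : 0 < k) (a : ℕ → ℝ≥0∞) :
    ∑' g : Fin k → ℕ, a (Finset.univ.sup g) ≤
      k * ∑' r : ℕ, ((r + 1 : ℕ) : ℝ≥0∞) ^ (k - 1) * a r := by
  classical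
  have : Nonempty (Fin k) := ⟨⟨0, hk⟩⟩
  set box : Fin k → ℕ → Finset (Fin k → ℕ) := fun m r =>
    Fintype.piFinset fun i => if i = m then {r} else Finset.range (r + 1) with hbox
  have hcard : ∀ m r, (box m r).card = (r + 1) ^ (k - 1) := fun m r => by
    have : ∀ i : Fin k, (if i = m then ({r} : Finset ℕ) else Finset.range (r + 1)).card =
        if i = m then 1 else r + 1 := fun i => by split_ifs <;> simp
    simp only [hbox, Fintype.card_piFinset, this]
    rw [Finset.prod_ite]
    simp [Finset.filter_ne']
  calc ∑' g : Fin k → ℕ, a (Finset.univ.sup g)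
      ≤ ∑' g : Fin k → ℕ, ∑' m : Fin k, ∑' r : ℕ, if g ∈ box m r then a r else 0 := by
        refine ENNReal.tsum_le_tsum fun g => ?_
        obtain ⟨m, -, hm⟩ := Finset.exists_mem_eq_sup Finset.univ Finset.univ_nonempty g
        refine le_trans ?_ (ENNReal.le_tsum m)
        refine le_trans ?_ (ENNReal.le_tsum (Finset.univ.sup g))
        rw [if_pos]
        simp only [hbox, Fintype.mem_piFinset]
        intro i
        split_ifs with hi
        · rw [hi, hm]; simp
        · exact Finset.mem_range.2 (Nat.lt_succ_of_le (Finset.le_sup (Finset.mem_univ i)))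
    _ = ∑' m : Fin k, ∑' r : ℕ, ∑' g : Fin k → ℕ, if g ∈ box m r then a r else 0 := by
        rw [ENNReal.tsum_comm]
        exact tsum_congr fun m => ENNReal.tsum_comm
    _ = ∑' m : Fin k, ∑' r : ℕ, ((r + 1 : ℕ) : ℝ≥0∞) ^ (k - 1) * a r := by
        refine tsum_congr fun m => tsum_congr fun r => ?_
        rw [tsum_eq_sum (s := box m r) fun g hg => if_neg hg,
          Finset.sum_congr rfl fun g hg => if_pos hg, Finset.sum_const, hcard]
        simp
    _ = _ := by simp [tsum_fintype]

/-- A functional on tuples that factorizes over a gap, up to an error governed by the size of the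
gap, and that vanishes on singletons has a sum over monotone `d`-tuples of order `d / 2`. -/
lemma exists_sum_monoTuples_le (a : ℕ → ℝ≥0∞) (Q : ℕ)
    (ha : ∑' r : ℕ, ((r + 1 : ℕ) : ℝ≥0∞) ^ (Q - 2) * a r ≠ ⊤) (d : ℕ) (hd1 : 1 ≤ d) (hdQ : d ≤ Q) :
    ∃ C : ℝ≥0∞, C ≠ ⊤ ∧ ∀ (n : ℕ) (v : ℝ≥0∞) (E : (e : ℕ) → (Fin e → ℕ) → ℝ≥0∞),
      (∀ t ∈ monoTuples n 1, E 1 t = 0) →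
      (∀ e, 2 ≤ e → e ≤ Q → ∀ t ∈ monoTuples n e, ∀ m (hm : m + 1 < e),
        E e t ≤ E (m + 1) (takeTuple (m + 1) hm.le t) * E (e - (m + 1)) (dropTuple (m + 1) t) +
          v * a (t ⟨m + 1, hm⟩ - t ⟨m, by omega⟩)) →
      1 ≤ n * v → ∑ t ∈ monoTuples n d, E d t ≤ C * (n * v) ^ ((d : ℝ) / 2) := by
  set S := ∑' r : ℕ, ((r + 1 : ℕ) : ℝ≥0∞) ^ (Q - 2) * a r
  induction d using Nat.strong_induction_on with
  | _ d ih =>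
  rcases hd1.eq_or_lt with rfl | hd2
  · refine ⟨0, by simp, fun n v E h1 _ _ => ?_⟩
    rw [Finset.sum_eq_zero h1]
    simp
  have ih' : ∀ e, e < d → 1 ≤ e → _ := fun e he h1 => ih e he h1 (he.le.trans hdQ)
  choose! C hC hbound using ih'
  obtain ⟨k, rfl⟩ : ∃ k, d = k + 1 := ⟨d - 1, by omega⟩
  refine ⟨∑ m : Fin k, C (m + 1) * C (k + 1 - (m + 1)) + k * S, ?_, ?_⟩
  · refine ENNReal.add_ne_top.2 ⟨ENNReal.sum_ne_top.2 fun m _ => ?_,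
      ENNReal.mul_ne_top (ENNReal.natCast_ne_top k) ha⟩
    exact ENNReal.mul_ne_top (hC _ (by omega) (by omega)) (hC _ (by omega) (by omega))
  intro n v E h1 h2 hnv
  -- Each tuple is cut at its largest gap. Since that position depends on the tuple, the product
  -- term is bounded by the sum over all cuts.
  have hpt : ∀ t ∈ monoTuples n (k + 1), E (k + 1) t ≤
      ∑ m : Fin k, E (m + 1) (takeTuple (m + 1) (by omega) t) *
        E (k + 1 - (m + 1)) (dropTuple (m + 1) t) + v * a (Finset.univ.sup (tupleGaps t)) := by
    intro t ht
    have : Nonempty (Fin k) := ⟨⟨0, by omega⟩⟩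
    obtain ⟨m, -, hm⟩ := Finset.exists_mem_eq_sup Finset.univ Finset.univ_nonempty (tupleGaps t)
    refine (h2 (k + 1) hd2 hdQ t ht m (by omega)).trans ?_
    refine add_le_add ?_ (le_of_eq ?_)
    · exact Finset.single_le_sum (f := fun m : Fin k =>
        E (m + 1) (takeTuple (m + 1) (by omega) t) *
          E (k + 1 - (m + 1)) (dropTuple (m + 1) t)) (fun _ _ => zero_le) (Finset.mem_univ m)
    · rw [hm]; rfl
  have hgap : ∑ t ∈ monoTuples n (k + 1), a (Finset.univ.sup (tupleGaps t)) ≤ n * (k * S) := by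
    refine (sum_comp_tupleGaps_le fun g => a (Finset.univ.sup g)).trans ?_
    gcongr
    refine (tsum_comp_sup_le (by omega) a).trans ?_
    gcongr
    refine ENNReal.tsum_le_tsum fun r => ?_
    refine mul_le_mul_left (pow_le_pow_right₀ ?_ (by omega)) _
    exact_mod_cast Nat.succ_le_succ (Nat.zero_le r)
  calc ∑ t ∈ monoTuples n (k + 1), E (k + 1) t
      ≤ _ := Finset.sum_le_sum hpt
    _ = ∑ m : Fin k, ∑ t ∈ monoTuples n (k + 1), E (m + 1) (takeTuple (m + 1) (by omega) t) *
          E (k + 1 - (m + 1)) (dropTuple (m + 1) t) +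
        v * ∑ t ∈ monoTuples n (k + 1), a (Finset.univ.sup (tupleGaps t)) := by
        rw [Finset.sum_add_distrib, Finset.sum_comm, Finset.mul_sum]
    _ ≤ ∑ m : Fin k, C (m + 1) * C (k + 1 - (m + 1)) * (n * v) ^ (((k + 1 : ℕ) : ℝ) / 2) +
        v * (n * (k * S)) := by
        gcongr with m
        refine (sum_take_mul_drop_le _ _ _).trans ?_
        refine (mul_le_mul' (hbound (m + 1) (by omega) (by omega) n v E h1 h2 hnv)
          (hbound (k + 1 - (m + 1)) (by omega) (by omega) n v E h1 h2 hnv)).trans_eq ?_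
        rw [mul_mul_mul_comm, ← ENNReal.rpow_add_of_nonneg _ _ (by positivity) (by positivity)]
        congr 2
        rw [← add_div, ← Nat.cast_add]
        congr 2
        omega
    _ ≤ _ := by
        rw [add_mul, Finset.sum_mul]
        refine add_le_add_right ?_ _
        -- The error is linear in `n * v`; it is absorbed because `1 ≤ n * v` and `1 ≤ (k + 1) / 2`.
        calc v * (n * (k * S)) = k * S * (n * v) ^ (1 : ℝ) := by rw [ENNReal.rpow_one]; ring
          _ ≤ _ := by
            gcongr
            have : (2 : ℝ) ≤ ((k + 1 : ℕ) : ℝ) := by exact_mod_cast hd2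
            linarith

/-! ### Moments of products -/

lemma enorm_finsetProd {ι : Type*} (s : Finset ι) (f : ι → ℝ) :
    ‖∏ i ∈ s, f i‖ₑ = ∏ i ∈ s, ‖f i‖ₑ := by
  classical
  induction s using Finset.induction_on with
  | empty => simp
  | insert i s hi ih => rw [Finset.prod_insert hi, Finset.prod_insert hi, enorm_mul, ih]

section Moments

variable {Ω : Type*} [MeasurableSpace Ω] {μ : Measure Ω}

lemma lintegral_rpow_le_rpow_lintegral_rpow [IsProbabilityMeasure μ] {g : Ω → ℝ≥0∞}
    (hg : Measurable g) {a b : ℝ} (ha : 0 < a) (hab : a ≤ b) :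
    ∫⁻ ω, g ω ^ a ∂μ ≤ (∫⁻ ω, g ω ^ b ∂μ) ^ (a / b) := by
  have hb : 0 < b := ha.trans_le hab
  have h := ENNReal.lintegral_mul_norm_pow_le (μ := μ) (f := fun ω => g ω ^ b) (g := fun _ => 1)
    (hg.pow_const b).aemeasurable aemeasurable_const (p := a / b) (q := 1 - a / b)
    (by positivity) (sub_nonneg.2 ((div_le_one hb).2 hab)) (by ring)
  simpa [← ENNReal.rpow_mul, mul_div_cancel₀ _ hb.ne'] using h

lemma integrable_of_lintegral_rpow_ne_top [IsFiniteMeasure μ] {f : Ω → ℝ} (hf : Measurable f)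
    {p : ℝ} (hp : 1 ≤ p) (h : ∫⁻ ω, ‖f ω‖ₑ ^ p ∂μ ≠ ⊤) : Integrable f μ := by
  refine ⟨hf.aestronglyMeasurable, ?_⟩
  have hle : ∀ x : ℝ≥0∞, x ≤ 1 + x ^ p := fun x => by
    rcases le_total x 1 with hx | hx
    · exact hx.trans le_self_add
    · calc x = x ^ (1 : ℝ) := (ENNReal.rpow_one x).symm
        _ ≤ x ^ p := ENNReal.rpow_le_rpow_of_exponent_le hx hp
        _ ≤ _ := le_add_self
  calc ∫⁻ ω, ‖f ω‖ₑ ∂μ ≤ ∫⁻ ω, (1 + ‖f ω‖ₑ ^ p) ∂μ := lintegral_mono fun ω => hle _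
    _ = μ Set.univ + ∫⁻ ω, ‖f ω‖ₑ ^ p ∂μ := by
      rw [lintegral_add_left measurable_const]; simp
    _ < ⊤ := ENNReal.add_lt_top.2 ⟨measure_lt_top μ _, h.lt_top⟩

lemma lintegral_enorm_sub_integral_rpow_le [IsProbabilityMeasure μ] {f : Ω → ℝ}
    (hf : Measurable f) {s : ℝ} (hs : 1 ≤ s) :
    ∫⁻ ω, ‖f ω - ∫ ω', f ω' ∂μ‖ₑ ^ s ∂μ ≤ 2 ^ s * ∫⁻ ω, ‖f ω‖ₑ ^ s ∂μ := by
  have hs0 : 0 < s := zero_lt_one.trans_le hs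
  set c := ∫ ω', f ω' ∂μ
  set A := ∫⁻ ω, ‖f ω‖ₑ ^ s ∂μ
  have hc : ‖c‖ₑ ^ s ≤ A := by
    calc ‖c‖ₑ ^ s ≤ (∫⁻ ω, ‖f ω‖ₑ ^ (1 : ℝ) ∂μ) ^ s := by
          gcongr
          simpa using enorm_integral_le_lintegral_enorm f
      _ ≤ (A ^ (1 / s)) ^ s := by
          gcongr
          exact lintegral_rpow_le_rpow_lintegral_rpow hf.enorm one_pos hs
      _ = A := by rw [← ENNReal.rpow_mul, one_div_mul_cancel hs0.ne', ENNReal.rpow_one]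
  calc ∫⁻ ω, ‖f ω - c‖ₑ ^ s ∂μ
      ≤ ∫⁻ ω, 2 ^ (s - 1) * (‖f ω‖ₑ ^ s + ‖c‖ₑ ^ s) ∂μ := by
        refine lintegral_mono fun ω => ?_
        refine le_trans ?_ (ENNReal.rpow_add_le_mul_rpow_add_rpow _ _ hs)
        gcongr
        exact enorm_sub_le
    _ = 2 ^ (s - 1) * (A + ‖c‖ₑ ^ s) := by
        rw [lintegral_const_mul _ ((hf.enorm.pow_const s).add_const _),
          lintegral_add_right _ measurable_const]
        simp [A]
    _ ≤ 2 ^ (s - 1) * (A + A) := by gcongr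
    _ = 2 ^ s * A := by
        rw [← two_mul, ← mul_assoc]
        congr 1
        nth_rw 2 [← ENNReal.rpow_one 2]
        rw [← ENNReal.rpow_add _ _ (by simp) (by simp), sub_add_cancel]

/-- Hölder's inequality with `m` equal weights `1 / m`. -/
lemma lintegral_enorm_prod_rpow_le {m : ℕ} (hm : 0 < m) {Z : Fin m → Ω → ℝ}
    (hZ : ∀ i, Measurable (Z i)) {s : ℝ} (hs : 0 ≤ s) {M : ℝ≥0∞}
    (hM : ∀ i, ∫⁻ ω, ‖Z i ω‖ₑ ^ s ∂μ ≤ M) :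
    ∫⁻ ω, ‖∏ i, Z i ω‖ₑ ^ (s / m) ∂μ ≤ M := by
  have hm' : (m : ℝ) ≠ 0 := by positivity
  have h := ENNReal.lintegral_prod_norm_pow_le (μ := μ) (Finset.univ : Finset (Fin m))
    (f := fun i ω => ‖Z i ω‖ₑ ^ s) (fun i _ => ((hZ i).enorm.pow_const s).aemeasurable)
    (p := fun _ => 1 / (m : ℝ)) (by simp [hm']) (fun _ _ => by positivity)
  calc ∫⁻ ω, ‖∏ i, Z i ω‖ₑ ^ (s / m) ∂μ = ∫⁻ ω, ∏ i, (‖Z i ω‖ₑ ^ s) ^ (1 / (m : ℝ)) ∂μ := by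
        refine lintegral_congr fun ω => ?_
        rw [enorm_finsetProd, ← ENNReal.prod_rpow_of_nonneg (by positivity)]
        refine Finset.prod_congr rfl fun i _ => ?_
        rw [← ENNReal.rpow_mul, mul_one_div]
    _ ≤ _ := h
    _ ≤ ∏ _i : Fin m, M ^ (1 / (m : ℝ)) := by
        refine Finset.prod_le_prod' fun i _ => ?_
        gcongr
        exact hM i
    _ = M := by
        rw [Finset.prod_const, Finset.card_univ, Fintype.card_fin, ← ENNReal.rpow_natCast,
          ← ENNReal.rpow_mul, one_div_mul_cancel hm', ENNReal.rpow_one]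

end Moments

lemma prod_eq_prod_take_mul_prod_drop {d m : ℕ} (h : m ≤ d) (t : Fin d → ℕ) (g : ℕ → ℝ) :
    ∏ i, g (t i) = (∏ i, g (takeTuple m h t i)) * ∏ i, g (dropTuple m t i) := by
  have key : ∀ l (hl : d = m + l), ∏ i, g (t i) =
      (∏ i, g (takeTuple m h t i)) * ∏ i : Fin l, g (t ⟨m + i, by omega⟩) := by
    rintro l rfl
    rw [Fin.prod_univ_add]
    rfl
  exact key (d - m) (by omega)

/-- Every tuple is sorted by some permutation, and each of the `d!` permutations acts injectively on
tuples. -/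
lemma sum_piFinset_le_factorial_mul {n d : ℕ} (E : (Fin d → ℕ) → ℝ≥0∞)
    (hE : ∀ (σ : Equiv.Perm (Fin d)) t, E (t ∘ σ) = E t) :
    ∑ t ∈ Fintype.piFinset fun _ : Fin d => Finset.Icc 1 n, E t ≤
      d.factorial * ∑ t ∈ monoTuples n d, E t := by
  classical
  calc ∑ t ∈ Fintype.piFinset fun _ : Fin d => Finset.Icc 1 n, E t
      ≤ ∑ t ∈ Fintype.piFinset fun _ : Fin d => Finset.Icc 1 n, ∑ σ : Equiv.Perm (Fin d),
          if Monotone (t ∘ σ) then E (t ∘ σ) else 0 := by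
        refine Finset.sum_le_sum fun t _ => ?_
        refine le_trans ?_ (Finset.single_le_sum (f := fun σ : Equiv.Perm (Fin d) =>
          if Monotone (t ∘ σ) then E (t ∘ σ) else 0) (fun _ _ => zero_le)
          (Finset.mem_univ (Tuple.sort t)))
        rw [if_pos (Tuple.monotone_sort t), hE]
    _ = ∑ σ : Equiv.Perm (Fin d), ∑ t ∈ Fintype.piFinset fun _ : Fin d => Finset.Icc 1 n,
          if Monotone (t ∘ σ) then E (t ∘ σ) else 0 := Finset.sum_comm
    _ ≤ ∑ _σ : Equiv.Perm (Fin d), ∑ t ∈ monoTuples n d, E t := by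
        refine Finset.sum_le_sum fun σ _ => ?_
        refine (sum_comp_le_of_injOn (t := Fintype.piFinset fun _ : Fin d => Finset.Icc 1 n)
          (φ := fun t : Fin d → ℕ => t ∘ σ)
          (h := fun t => if Monotone t then E t else 0) (fun t ht => ?_)
          (σ.surjective.injective_comp_right.injOn)).trans_eq ?_
        · exact Fintype.mem_piFinset.2 fun i => Fintype.mem_piFinset.1 ht (σ i)
        · rw [← Finset.sum_filter, monoTuples]
    _ = _ := by
        rw [Finset.sum_const, Finset.card_univ, Fintype.card_perm, Fintype.card_fin, nsmul_eq_mul]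

lemma measurable_rowSigma {Ω 𝒳 : Type*} [MeasurableSpace 𝒳] {X : ℕ → ℕ → Ω → 𝒳}
    {n a b j : ℕ} (hj : j ∈ Finset.Icc a b) {g : 𝒳 → ℝ} (hg : Measurable g) :
    Measurable[rowSigma X n a b] fun ω => g (X n j ω) := by
  have h1 : Measurable[MeasurableSpace.comap (X n j) inferInstance] fun ω => g (X n j ω) :=
    hg.comp (comap_measurable (X n j))
  exact h1.mono (le_iSup₂ (f := fun j (_ : j ∈ Finset.Icc a b) =>
    MeasurableSpace.comap (X n j) inferInstance) j hj) le_rfl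

/-! ### Splitting product moments along a row at a gap. -/

section Row

variable {Ω 𝒳 : Type*} [mΩ : MeasurableSpace Ω] [MeasurableSpace 𝒳] {μ : Measure Ω}
  [IsProbabilityMeasure μ] {X : ℕ → ℕ → Ω → 𝒳}

lemma rowSigma_le (hX : ∀ n, ∀ t ∈ Finset.Icc 1 n, Measurable (X n t)) {n a b : ℕ} (ha : 1 ≤ a)
    (hb : b ≤ n) : rowSigma X n a b ≤ mΩ := by
  refine iSup₂_le fun j hj => ?_
  rw [Finset.mem_Icc] at hj
  exact (hX n j (Finset.mem_Icc.2 ⟨ha.trans hj.1, hj.2.trans hb⟩)).comap_le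

lemma mixingLE_alpha {n k l : ℕ} (hk : 1 ≤ k) (hkl : k ≤ l) (hl : l ≤ n) :
    MixingLE μ (rowSigma X n 1 k) (rowSigma X n l n) (alpha μ X (l - k)) := by
  rcases hkl.eq_or_lt with rfl | hlt
  · simpa [alpha] using mixingLE_one (μ := μ)
  · intro A B hA hB
    obtain ⟨r, rfl⟩ := Nat.exists_eq_add_of_lt hlt
    have hr : k + r + 1 - k = r + 1 := by omega
    rw [hr, alpha, if_neg (Nat.succ_ne_zero r)]
    refine le_trans ?_ (le_iSup _ n)
    unfold alphaRow
    refine le_trans ?_ (le_iSup₂ k (Finset.mem_Icc.2 ⟨hk, by omega⟩))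
    refine le_trans ?_ (le_iSup₂ A hA)
    exact le_iSup₂ (f := fun (B : Set Ω) (_ : MeasurableSet[rowSigma X n (k + (r + 1)) n] B) =>
      ENNReal.ofReal |μ.real (A ∩ B) - μ.real A * μ.real B|) B hB

/-- Splitting an expectation of a product at one of its gaps. -/
lemma enorm_integral_prod_le (hX : ∀ n, ∀ t ∈ Finset.Icc 1 n, Measurable (X n t)) {γ : ℝ}
    (hγ : 0 < γ) {n d m : ℕ} (hm : m + 1 < d) {g : ℕ → 𝒳 → ℝ} (hg : ∀ j, Measurable (g j))
    {M : ℝ≥0∞} (hM : M ≠ ⊤)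
    (hgM : ∀ j ∈ Finset.Icc 1 n, ∫⁻ ω, ‖g j (X n j ω)‖ₑ ^ (d * ((2 + γ) / 2)) ∂μ ≤ M)
    {t : Fin d → ℕ} (ht : t ∈ monoTuples n d) :
    ‖∫ ω, ∏ i, g (t i) (X n (t i) ω) ∂μ‖ₑ ≤
      ‖∫ ω, ∏ i, g (takeTuple (m + 1) hm.le t i) (X n (takeTuple (m + 1) hm.le t i) ω) ∂μ‖ₑ *
        ‖∫ ω, ∏ i, g (dropTuple (m + 1) t i) (X n (dropTuple (m + 1) t i) ω) ∂μ‖ₑ +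
      4 * (alpha μ X (t ⟨m + 1, hm⟩ - t ⟨m, by omega⟩) ^ (γ / (2 + γ)) * M ^ (2 / (2 + γ))) := by
  obtain ⟨htI, htm⟩ := mem_monoTuples.1 ht
  have hd0 : (0 : ℝ) < d := by exact_mod_cast (by omega : 0 < d)
  have hγ2 : 0 < 2 + γ := by linarith
  set s : ℝ := d * ((2 + γ) / 2) with hs
  have hs0 : 0 < s := by positivity
  set U : Ω → ℝ := fun ω =>
    ∏ i, g (takeTuple (m + 1) hm.le t i) (X n (takeTuple (m + 1) hm.le t i) ω) with hU
  set V : Ω → ℝ := fun ω => ∏ i, g (dropTuple (m + 1) t i) (X n (dropTuple (m + 1) t i) ω) with hV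
  have hprod : ∀ ω, ∏ i, g (t i) (X n (t i) ω) = U ω * V ω := fun ω =>
    prod_eq_prod_take_mul_prod_drop hm.le t fun j => g j (X n j ω)
  have hZm : ∀ i, Measurable fun ω => g (t i) (X n (t i) ω) := fun i =>
    (hg _).comp (hX n _ (htI i))
  set k := t ⟨m, by omega⟩ with hk
  set l := t ⟨m + 1, hm⟩ with hl
  have hk1 := Finset.mem_Icc.1 (htI ⟨m, by omega⟩)
  have hl1 := Finset.mem_Icc.1 (htI ⟨m + 1, hm⟩)
  have hkl : k ≤ l := htm (by simp)
  have hm1 : rowSigma X n 1 k ≤ mΩ := rowSigma_le hX le_rfl hk1.2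
  have hm2 : rowSigma X n l n ≤ mΩ := rowSigma_le hX hl1.1 le_rfl
  have hUm : Measurable[rowSigma X n 1 k] U := by
    refine Finset.measurable_prod _ fun i _ => measurable_rowSigma ?_ (hg _)
    refine Finset.mem_Icc.2 ⟨(Finset.mem_Icc.1 (htI _)).1, htm ?_⟩
    exact Nat.lt_succ_iff.1 i.2
  have hVm : Measurable[rowSigma X n l n] V := by
    refine Finset.measurable_prod _ fun i _ => measurable_rowSigma ?_ (hg _)
    refine Finset.mem_Icc.2 ⟨htm ?_, (Finset.mem_Icc.1 (htI _)).2⟩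
    exact Nat.le_add_right _ _
  have hUM : ∫⁻ ω, ‖U ω‖ₑ ^ (s / (m + 1 : ℕ)) ∂μ ≤ M :=
    lintegral_enorm_prod_rpow_le (Nat.succ_pos m) (fun i => hZm _) hs0.le fun i => hgM _ (htI _)
  have hVM : ∫⁻ ω, ‖V ω‖ₑ ^ (s / (d - (m + 1) : ℕ)) ∂μ ≤ M :=
    lintegral_enorm_prod_rpow_le (by omega) (fun i => hZm _) hs0.le fun i => hgM _ (htI _)
  have hUVM : ∫⁻ ω, ‖∏ i, g (t i) (X n (t i) ω)‖ₑ ^ (s / d) ∂μ ≤ M :=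
    lintegral_enorm_prod_rpow_le (by omega) hZm hs0.le fun i => hgM _ (htI _)
  have hexp : ∀ e : ℕ, 0 < e → e ≤ d → 1 ≤ s / e := fun e he hed => by
    have he' : (0 : ℝ) < e := by exact_mod_cast he
    have hed' : (e : ℝ) ≤ d := by exact_mod_cast hed
    rw [le_div_iff₀ he', hs]
    nlinarith
  have hUint : Integrable U μ := integrable_of_lintegral_rpow_ne_top (hUm.mono hm1 le_rfl)
    (hexp (m + 1) (by omega) (by omega)) (hUM.trans_lt hM.lt_top).ne
  have hVint : Integrable V μ := integrable_of_lintegral_rpow_ne_top (hVm.mono hm2 le_rfl)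
    (hexp (d - (m + 1)) (by omega) (by omega)) (hVM.trans_lt hM.lt_top).ne
  have hUVint : Integrable (fun ω => U ω * V ω) μ := by
    simp_rw [← hprod]
    exact integrable_of_lintegral_rpow_ne_top (Finset.measurable_prod _ fun i _ => hZm i)
      (hexp d (by omega) le_rfl) (hUVM.trans_lt hM.lt_top).ne
  have hm0 : (0 : ℝ) < (m + 1 : ℕ) := by positivity
  have hdm0 : (0 : ℝ) < (d - (m + 1) : ℕ) := by exact_mod_cast (by omega : 0 < d - (m + 1))
  -- The Hölder exponents of the two blocks add up to `d / s` whatever the cut, which leaves exactly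
  -- `γ / (2 + γ)` for the mixing coefficient.
  have hsum1 : 1 / (s / (m + 1 : ℕ)) + 1 / (s / (d - (m + 1) : ℕ)) = 2 / (2 + γ) := by
    rw [one_div_div, one_div_div, ← add_div, ← Nat.cast_add, Nat.add_sub_cancel' hm.le, hs]
    field_simp
  have hcov := (mixingLE_alpha (μ := μ) (X := X) hk1.1 hkl hl1.2).ofReal_abs_cov_le hm1 hm2 hUm hVm
    hUint hVint hUVint (θ := γ / (2 + γ)) (by positivity)
    (div_pos hs0 hm0) (div_pos hs0 hdm0) (by rw [add_assoc, hsum1]; field_simp; ring)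
  simp_rw [hprod]
  rw [← enorm_mul]
  calc ‖∫ ω, U ω * V ω ∂μ‖ₑ = ‖(∫ ω, U ω ∂μ) * (∫ ω, V ω ∂μ) +
        (∫ ω, U ω * V ω ∂μ - (∫ ω, U ω ∂μ) * ∫ ω, V ω ∂μ)‖ₑ := by congr 1; ring
    _ ≤ ‖(∫ ω, U ω ∂μ) * (∫ ω, V ω ∂μ)‖ₑ +
        ‖∫ ω, U ω * V ω ∂μ - (∫ ω, U ω ∂μ) * ∫ ω, V ω ∂μ‖ₑ := enorm_add_le _ _
    _ ≤ _ := by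
      gcongr
      rw [Real.enorm_eq_ofReal_abs]
      refine hcov.trans ?_
      rw [mul_assoc (alpha μ X (l - k) ^ (γ / (2 + γ)))]
      gcongr
      rw [← hsum1, ENNReal.rpow_add_of_nonneg _ _ (by positivity) (by positivity)]
      gcongr

end Row

/-! ### Moment inequality for the empirical process -/

lemma empirical_one {Ω 𝒳 : Type*} [MeasurableSpace Ω] {μ : Measure Ω} {X : ℕ → ℕ → Ω → 𝒳} (n : ℕ) (f : 𝒳 → ℝ) (ω : Ω) : empirical μ X n 1 f ω =
    1 / √(n : ℝ) * ∑ i ∈ Finset.Icc 1 n, (f (X n i ω) - ∫ ω', f (X n i ω') ∂μ) := by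
  simp [empirical]

section Row

variable {Ω 𝒳 : Type*} [mΩ : MeasurableSpace Ω] [MeasurableSpace 𝒳] {μ : Measure Ω}
  {X : ℕ → ℕ → Ω → 𝒳}

/-- The series is extended to gap zero; shifting the weights costs a factor `2 ^ (Q - 2)`, since `r
+ 2 ≤ 2 * (r + 1)`. -/
lemma tsum_alpha_ne_top {Q : ℕ} {θ : ℝ}
    (hsum : ∑' t : ℕ, ((t + 1 : ℕ) : ℝ≥0∞) ^ (Q - 2) * alpha μ X (t + 1) ^ θ < ⊤) :
    ∑' r : ℕ, ((r + 1 : ℕ) : ℝ≥0∞) ^ (Q - 2) * alpha μ X r ^ θ ≠ ⊤ := by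
  rw [tsum_eq_zero_add' ENNReal.summable]
  refine ENNReal.add_ne_top.2 ⟨by simp [alpha], ?_⟩
  refine ne_top_of_le_ne_top (ENNReal.mul_ne_top
    (ENNReal.pow_ne_top (a := 2) (n := Q - 2) (by simp)) hsum.ne) ?_
  rw [← ENNReal.tsum_mul_left]
  refine ENNReal.tsum_le_tsum fun r => ?_
  rw [← mul_assoc, ← mul_pow]
  gcongr
  have : r + 1 + 1 ≤ 2 * (r + 1) := by omega
  exact_mod_cast this

variable [IsProbabilityMeasure μ]

/-- `exists_sum_monoTuples_le` is applied to the absolute product moments of the centred variables;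
centring makes those of single entries vanish. Evenness of `Q` removes the absolute value before the
power is expanded. -/
lemma exists_lintegral_empirical_le (hX : ∀ n, ∀ t ∈ Finset.Icc 1 n, Measurable (X n t))
    {Q : ℕ} (hQ : 2 ≤ Q) (hQeven : Even Q) {γ : ℝ} (hγ : 0 < γ)
    (hsum : ∑' t : ℕ, ((t + 1 : ℕ) : ℝ≥0∞) ^ (Q - 2) * alpha μ X (t + 1) ^ (γ / (2 + γ)) < ⊤) :
    ∃ C : ℝ≥0∞, C ≠ ⊤ ∧ ∀ (n : ℕ) (f : 𝒳 → ℝ), Measurable f → ∀ v : ℝ≥0∞, v ≠ ⊤ → 1 ≤ n * v →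
      (∀ i ∈ Finset.Icc 2 Q, ∀ t ∈ Finset.Icc 1 n,
        ∫⁻ ω, ‖f (X n t ω)‖ₑ ^ (i * ((2 + γ) / 2)) ∂μ ≤ v ^ ((2 + γ) / 2)) →
      (∫⁻ ω, ‖empirical μ X n 1 f ω‖ₑ ^ (Q : ℝ) ∂μ) ^ (1 / (Q : ℝ)) ≤ C * v ^ (1 / 2 : ℝ) := by
  have hγ2 : 0 < 2 + γ := by linarith
  have hQ0 : (0 : ℝ) < Q := by exact_mod_cast (by omega : 0 < Q)
  -- The 4 is from the covariance inequality, the `2 ^ Q` from centring.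
  set a : ℕ → ℝ≥0∞ := fun r => 4 * 2 ^ (Q : ℝ) * alpha μ X r ^ (γ / (2 + γ)) with ha
  have ha_sum : ∑' r : ℕ, ((r + 1 : ℕ) : ℝ≥0∞) ^ (Q - 2) * a r ≠ ⊤ := by
    simp_rw [ha, mul_left_comm _ (4 * 2 ^ (Q : ℝ) : ℝ≥0∞)]
    rw [ENNReal.tsum_mul_left]
    refine ENNReal.mul_ne_top (ENNReal.mul_ne_top (by simp)
      (ENNReal.rpow_ne_top_of_nonneg hQ0.le (by simp))) (tsum_alpha_ne_top hsum)
  obtain ⟨C, hC, hbound⟩ := exists_sum_monoTuples_le a Q ha_sum Q (by omega) le_rfl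
  refine ⟨(Q.factorial * C) ^ (1 / (Q : ℝ)), ENNReal.rpow_ne_top_of_nonneg (by positivity)
    (ENNReal.mul_ne_top (ENNReal.natCast_ne_top _) hC), ?_⟩
  intro n f hf v hv hnv hmom
  have hn0 : n ≠ 0 := by rintro rfl; simp at hnv
  set g : ℕ → 𝒳 → ℝ := fun j x => f x - ∫ ω', f (X n j ω') ∂μ with hgdef
  have hg : ∀ j, Measurable (g j) := fun j => hf.sub_const _
  have hfm : ∀ j ∈ Finset.Icc 1 n, Measurable fun ω => f (X n j ω) := fun j hj =>
    hf.comp (hX n j hj)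
  have hvtop : v ^ ((2 + γ) / 2) ≠ ⊤ := ENNReal.rpow_ne_top_of_nonneg (by positivity) hv
  have hexp : ∀ e : ℕ, 2 ≤ e → 1 ≤ (e : ℝ) * ((2 + γ) / 2) := fun e he => by
    have : (2 : ℝ) ≤ e := by exact_mod_cast he
    nlinarith
  have hgM : ∀ e, 2 ≤ e → e ≤ Q → ∀ j ∈ Finset.Icc 1 n,
      ∫⁻ ω, ‖g j (X n j ω)‖ₑ ^ (e * ((2 + γ) / 2)) ∂μ ≤
        2 ^ (e * ((2 + γ) / 2)) * v ^ ((2 + γ) / 2) := fun e he heQ j hj =>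
    (lintegral_enorm_sub_integral_rpow_le (hfm j hj) (hexp e he)).trans
      (mul_le_mul_right (hmom e (Finset.mem_Icc.2 ⟨he, heQ⟩) j hj) _)
  have hMtop : ∀ e : ℕ, (2 : ℝ≥0∞) ^ ((e : ℝ) * ((2 + γ) / 2)) * v ^ ((2 + γ) / 2) ≠ ⊤ := fun e =>
    ENNReal.mul_ne_top (ENNReal.rpow_ne_top_of_nonneg (by positivity) (by simp)) hvtop
  set E : (e : ℕ) → (Fin e → ℕ) → ℝ≥0∞ := fun e t => ‖∫ ω, ∏ i, g (t i) (X n (t i) ω) ∂μ‖ₑ with hE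
  have hE1 : ∀ t ∈ monoTuples n 1, E 1 t = 0 := by
    intro t ht
    have hj := (mem_monoTuples.1 ht).1 0
    have hfinite : Integrable (fun ω => f (X n (t 0) ω)) μ :=
      integrable_of_lintegral_rpow_ne_top (hfm _ hj) (hexp 2 le_rfl)
        ((hmom 2 (Finset.mem_Icc.2 ⟨le_rfl, hQ⟩) _ hj).trans_lt hvtop.lt_top).ne
    simp only [hE, hgdef, Finset.univ_unique, Fin.default_eq_zero, Finset.prod_singleton]
    rw [integral_sub hfinite (integrable_const _)]
    simp
  have hE2 : ∀ e, 2 ≤ e → e ≤ Q → ∀ t ∈ monoTuples n e, ∀ m (hm : m + 1 < e),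
      E e t ≤ E (m + 1) (takeTuple (m + 1) hm.le t) * E (e - (m + 1)) (dropTuple (m + 1) t) +
        v * a (t ⟨m + 1, hm⟩ - t ⟨m, by omega⟩) := by
    intro e he heQ t ht m hm
    refine (enorm_integral_prod_le hX hγ hm hg (hMtop e) (hgM e he heQ) ht).trans ?_
    refine add_le_add_right ?_ _
    have hpow : ((2 : ℝ≥0∞) ^ ((e : ℝ) * ((2 + γ) / 2)) * v ^ ((2 + γ) / 2)) ^ (2 / (2 + γ)) ≤
        2 ^ (Q : ℝ) * v := by
      rw [ENNReal.mul_rpow_of_nonneg _ _ (by positivity), ← ENNReal.rpow_mul, ← ENNReal.rpow_mul]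
      have e1 : (e : ℝ) * ((2 + γ) / 2) * (2 / (2 + γ)) = e := by field_simp
      have e2 : (2 + γ) / 2 * (2 / (2 + γ)) = 1 := by field_simp
      rw [e1, e2, ENNReal.rpow_one]
      gcongr
      exact one_le_two
    refine (mul_le_mul_right (mul_le_mul_right hpow _) _).trans_eq ?_
    simp only [ha]
    ring
  have hmain := hbound n v E hE1 hE2 hnv
  have hprodint : ∀ t ∈ Fintype.piFinset fun _ : Fin Q => Finset.Icc 1 n,
      Integrable (fun ω => ∏ i, g (t i) (X n (t i) ω)) μ := by
    intro t ht
    rw [Fintype.mem_piFinset] at ht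
    refine integrable_of_lintegral_rpow_ne_top
      (Finset.measurable_prod _ fun i _ => (hg _).comp (hX n _ (ht i)))
      (p := Q * ((2 + γ) / 2) / Q) ?_ ((lintegral_enorm_prod_rpow_le (by omega)
        (fun i => (hg _).comp (hX n _ (ht i))) (by positivity)
        fun i => hgM Q hQ le_rfl _ (ht i)).trans_lt (hMtop Q).lt_top).ne
    rw [le_div_iff₀ hQ0]
    nlinarith
  have hS : ∫⁻ ω, ‖∑ j ∈ Finset.Icc 1 n, g j (X n j ω)‖ₑ ^ (Q : ℝ) ∂μ ≤
      Q.factorial * (C * (n * v) ^ ((Q : ℝ) / 2)) := by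
    have h1 : ∀ ω, ‖∑ j ∈ Finset.Icc 1 n, g j (X n j ω)‖ₑ ^ (Q : ℝ) =
        ENNReal.ofReal (∑ t ∈ Fintype.piFinset fun _ : Fin Q => Finset.Icc 1 n,
          ∏ i, g (t i) (X n (t i) ω)) := fun ω => by
      rw [← Finset.sum_pow' _ (fun j => g j (X n j ω)), ENNReal.rpow_natCast, ← enorm_pow,
        Real.enorm_of_nonneg (hQeven.pow_nonneg _)]
    have h2 : ∀ ω, 0 ≤ ∑ t ∈ Fintype.piFinset fun _ : Fin Q => Finset.Icc 1 n,
        ∏ i, g (t i) (X n (t i) ω) := fun ω => by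
      rw [← Finset.sum_pow' _ (fun j => g j (X n j ω))]
      exact hQeven.pow_nonneg _
    rw [lintegral_congr h1, ← ofReal_integral_eq_lintegral_ofReal
      (integrable_finsetSum _ hprodint) (Eventually.of_forall h2),
      integral_finsetSum _ hprodint]
    calc _ ≤ ‖∑ t ∈ Fintype.piFinset fun _ : Fin Q => Finset.Icc 1 n,
            ∫ ω, ∏ i, g (t i) (X n (t i) ω) ∂μ‖ₑ := by
          rw [Real.enorm_eq_ofReal_abs]
          exact ENNReal.ofReal_le_ofReal (le_abs_self _)
      _ ≤ ∑ t ∈ Fintype.piFinset fun _ : Fin Q => Finset.Icc 1 n, E Q t := enorm_sum_le _ _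
      _ ≤ Q.factorial * ∑ t ∈ monoTuples n Q, E Q t := by
          refine sum_piFinset_le_factorial_mul _ fun σ t => ?_
          simp only [hE, Function.comp]
          congr 2
          funext ω
          exact Equiv.prod_comp σ fun i => g (t i) (X n (t i) ω)
      _ ≤ _ := by gcongr
  have hsqrt : ‖1 / √(n : ℝ)‖ₑ * (n : ℝ≥0∞) ^ (1 / 2 : ℝ) = 1 := by
    have hn : (0 : ℝ) < n := by exact_mod_cast Nat.pos_of_ne_zero hn0
    rw [Real.enorm_of_nonneg (by positivity), ← ENNReal.ofReal_natCast,
      ENNReal.ofReal_rpow_of_nonneg hn.le (by norm_num), ← ENNReal.ofReal_mul (by positivity),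
      ← Real.sqrt_eq_rpow, one_div_mul_cancel (Real.sqrt_pos.2 hn).ne', ENNReal.ofReal_one]
  have hemp : ∀ ω, ‖empirical μ X n 1 f ω‖ₑ ^ (Q : ℝ) = ‖1 / √(n : ℝ)‖ₑ ^ (Q : ℝ) *
      ‖∑ j ∈ Finset.Icc 1 n, g j (X n j ω)‖ₑ ^ (Q : ℝ) := fun ω => by
    rw [empirical_one, enorm_mul, ENNReal.mul_rpow_of_nonneg _ _ hQ0.le]
  calc (∫⁻ ω, ‖empirical μ X n 1 f ω‖ₑ ^ (Q : ℝ) ∂μ) ^ (1 / (Q : ℝ))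
      ≤ (‖1 / √(n : ℝ)‖ₑ ^ (Q : ℝ) * (Q.factorial * (C * (n * v) ^ ((Q : ℝ) / 2)))) ^
          (1 / (Q : ℝ)) := by
        rw [lintegral_congr hemp, lintegral_const_mul' _ _
          (ENNReal.rpow_ne_top_of_nonneg hQ0.le enorm_ne_top)]
        gcongr
    _ = ‖1 / √(n : ℝ)‖ₑ * ((Q.factorial * C) ^ (1 / (Q : ℝ)) *
          ((n : ℝ≥0∞) ^ (1 / 2 : ℝ) * v ^ (1 / 2 : ℝ))) := by
        rw [← mul_assoc (Q.factorial : ℝ≥0∞), ENNReal.mul_rpow_of_nonneg _ _ (by positivity),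
          ENNReal.mul_rpow_of_nonneg _ _ (by positivity), ← ENNReal.rpow_mul, ← ENNReal.rpow_mul,
          mul_one_div_cancel hQ0.ne', ENNReal.rpow_one]
        have : (Q : ℝ) / 2 * (1 / Q) = 1 / 2 := by field_simp
        rw [this, ENNReal.mul_rpow_of_nonneg (n : ℝ≥0∞) v (by positivity)]
    _ = (‖1 / √(n : ℝ)‖ₑ * (n : ℝ≥0∞) ^ (1 / 2 : ℝ)) * ((Q.factorial * C) ^ (1 / (Q : ℝ)) *
          v ^ (1 / 2 : ℝ)) := by ring
    _ = _ := by rw [hsqrt, one_mul]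

end Row

/-! ### The entropy integral -/

section Entropy

variable {𝒳 : Type*} [MeasurableSpace 𝒳] {ρ : (𝒳 → ℝ) → ℝ≥0∞} {F : Set (𝒳 → ℝ)}

lemma bracketingNumber_anti : Antitone (bracketingNumber ρ F) := by
  intro ε ε' h
  refine le_iInf₂ fun N hN => ?_
  obtain ⟨A, B, hA, hB, hAF, hBρ, hbr⟩ := hN
  exact iInf₂_le N ⟨A, B, hA, hB, hAF,
    fun b hb => ⟨(hBρ b hb).1, (hBρ b hb).2.trans_le (ENNReal.ofReal_le_ofReal h)⟩, hbr⟩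

/-- The integrand is antitone, so on `(2^(-k-1), 2^(-k)]`, of length `2^(-k) / 2`, it is at least
its value at the right end. -/
lemma tsum_dyadic_bracketingNumber_ne_top {r θ : ℝ} (hθ : 0 ≤ θ) (hr : 0 ≤ r)
    (h : ∫⁻ x in Set.Ioc (0 : ℝ) 1, ENNReal.ofReal (x ^ (-θ)) *
      (bracketingNumber ρ F x : ℝ≥0∞) ^ r < ⊤) :
    ∑' k : ℕ, ENNReal.ofReal (((1 / 2 : ℝ) ^ k) ^ (1 - θ)) *
      (bracketingNumber ρ F ((1 / 2 : ℝ) ^ k) : ℝ≥0∞) ^ r ≠ ⊤ := by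
  set s : ℕ → Set ℝ := fun k => Set.Ioc ((1 / 2 : ℝ) ^ (k + 1)) ((1 / 2 : ℝ) ^ k) with hs
  have hanti : Antitone fun k : ℕ => (1 / 2 : ℝ) ^ k := fun a b hab =>
    pow_le_pow_of_le_one (by norm_num) (by norm_num) hab
  have hdisj : Pairwise (Function.onFun Disjoint s) := hanti.pairwise_disjoint_on_Ioc_succ
  have hsub : (⋃ k, s k) ⊆ Set.Ioc 0 1 := Set.iUnion_subset fun k x hx =>
    ⟨(by positivity : (0 : ℝ) < (1 / 2) ^ (k + 1)).trans hx.1,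
      hx.2.trans (pow_le_one₀ (by norm_num) (by norm_num))⟩
  have hle : ∑' k : ℕ, ENNReal.ofReal (1 / 2) * (ENNReal.ofReal (((1 / 2 : ℝ) ^ k) ^ (1 - θ)) *
      (bracketingNumber ρ F ((1 / 2 : ℝ) ^ k) : ℝ≥0∞) ^ r) ≤
      ∫⁻ x in Set.Ioc (0 : ℝ) 1, ENNReal.ofReal (x ^ (-θ)) *
        (bracketingNumber ρ F x : ℝ≥0∞) ^ r := by
    refine le_trans ?_ (lintegral_mono_set hsub)
    rw [lintegral_iUnion (fun k => measurableSet_Ioc) hdisj]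
    refine ENNReal.tsum_le_tsum fun k => ?_
    have hk0 : (0 : ℝ) < (1 / 2) ^ k := by positivity
    calc _ = ∫⁻ _x in s k, ENNReal.ofReal (((1 / 2 : ℝ) ^ k) ^ (-θ)) *
          (bracketingNumber ρ F ((1 / 2 : ℝ) ^ k) : ℝ≥0∞) ^ r := by
          rw [setLIntegral_const, Real.volume_Ioc, mul_right_comm, ← mul_assoc,
            ← ENNReal.ofReal_mul (by norm_num), ← ENNReal.ofReal_mul (by positivity)]
          congr 2
          rw [sub_eq_add_neg, Real.rpow_add hk0, Real.rpow_one, pow_succ]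
          ring
      _ ≤ _ := by
          refine setLIntegral_mono' measurableSet_Ioc fun x hx => ?_
          have hx0 : 0 < x := (by positivity : (0 : ℝ) < (1 / 2) ^ (k + 1)).trans hx.1
          gcongr ?_ * ?_ ^ r
          · exact ENNReal.ofReal_le_ofReal
              (Real.rpow_le_rpow_of_nonpos hx0 hx.2 (neg_nonpos.2 hθ))
          · exact_mod_cast bracketingNumber_anti hx.2
  rw [ENNReal.tsum_mul_left] at hle
  intro htop
  rw [htop, ENNReal.mul_top (by simp)] at hle
  exact absurd h (not_lt.2 hle)

end Entropy

/-! ### `L^q` norms and chaining -/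

/-- The `L^q` norm of a function with values in `[0, ∞]`. -/
def lqNorm {Ω : Type*} [MeasurableSpace Ω] (μ : Measure Ω) (q : ℝ) (U : Ω → ℝ≥0∞) : ℝ≥0∞ :=
  (∫⁻ ω, U ω ^ q ∂μ) ^ (1 / q)

/-- The `ℓ^q` norm of a finite family. -/
def lqSum {ι : Type*} (q : ℝ) (s : Finset ι) (u : ι → ℝ≥0∞) : ℝ≥0∞ :=
  (∑ i ∈ s, u i ^ q) ^ (1 / q)

lemma le_lqSum {ι : Type*} {q : ℝ} (hq : 0 < q) {s : Finset ι} {i : ι} (hi : i ∈ s)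
    (u : ι → ℝ≥0∞) : u i ≤ lqSum q s u := by
  calc u i = (u i ^ q) ^ (1 / q) := by
        rw [← ENNReal.rpow_mul, mul_one_div_cancel hq.ne', ENNReal.rpow_one]
    _ ≤ _ := by
        unfold lqSum
        gcongr
        exact Finset.single_le_sum (f := fun i => u i ^ q) (fun _ _ => zero_le) hi

section LqNorm

variable {Ω : Type*} [MeasurableSpace Ω] {μ : Measure Ω} {q : ℝ}

lemma lqNorm_add_le (hq : 1 ≤ q) {U V : Ω → ℝ≥0∞} (hU : Measurable U) (hV : Measurable V) :
    lqNorm μ q (fun ω => U ω + V ω) ≤ lqNorm μ q U + lqNorm μ q V :=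
  ENNReal.lintegral_Lp_add_le hU.aemeasurable hV.aemeasurable hq

lemma lqNorm_sum_le (hq : 1 ≤ q) {ι : Type*} (s : Finset ι) {U : ι → Ω → ℝ≥0∞}
    (hU : ∀ i, Measurable (U i)) :
    lqNorm μ q (fun ω => ∑ i ∈ s, U i ω) ≤ ∑ i ∈ s, lqNorm μ q (U i) := by
  classical
  have hq0 : 0 < q := zero_lt_one.trans_le hq
  induction s using Finset.induction_on with
  | empty => simp [lqNorm, hq0]
  | insert i s hi ih =>
    simp_rw [Finset.sum_insert hi]
    exact (lqNorm_add_le hq (hU i) (Finset.measurable_sum s fun j _ => hU j)).trans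
      (add_le_add_right ih _)

lemma lqNorm_const_mul (hq : 0 < q) (c : ℝ≥0∞) {U : Ω → ℝ≥0∞} (hU : Measurable U) :
    lqNorm μ q (fun ω => c * U ω) = c * lqNorm μ q U := by
  unfold lqNorm
  simp_rw [ENNReal.mul_rpow_of_nonneg _ _ hq.le]
  rw [lintegral_const_mul _ (hU.pow_const q), ENNReal.mul_rpow_of_nonneg _ _ (by positivity),
    ← ENNReal.rpow_mul, mul_one_div_cancel hq.ne', ENNReal.rpow_one]

lemma lqNorm_const [IsProbabilityMeasure μ] (hq : 0 < q) (c : ℝ≥0∞) :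
    lqNorm μ q (fun _ => c) = c := by
  simp [lqNorm, ← ENNReal.rpow_mul, mul_inv_cancel₀ hq.ne']

lemma measurable_lqSum {ι : Type*} {s : Finset ι} {u : ι → Ω → ℝ≥0∞}
    (hu : ∀ i ∈ s, Measurable (u i)) : Measurable fun ω => lqSum q s fun i => u i ω :=
  (Finset.measurable_sum s fun i hi => (hu i hi).pow_const q).pow_const _

/-- The maximal inequality of the chaining: with `le_lqSum`, a maximum over `s` costs only the
factor `s.card ^ (1 / q)`. -/
lemma lqNorm_lqSum_le (hq : 0 < q) {ι : Type*} {s : Finset ι} {u : ι → Ω → ℝ≥0∞}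
    (hu : ∀ i ∈ s, Measurable (u i)) {c : ℝ≥0∞} (hc : ∀ i ∈ s, lqNorm μ q (u i) ≤ c) :
    lqNorm μ q (fun ω => lqSum q s fun i => u i ω) ≤ (s.card : ℝ≥0∞) ^ (1 / q) * c := by
  have hpow : ∀ x : ℝ≥0∞, (x ^ (1 / q)) ^ q = x := fun x => by
    rw [← ENNReal.rpow_mul, one_div_mul_cancel hq.ne', ENNReal.rpow_one]
  have h1 : ∀ i ∈ s, ∫⁻ ω, u i ω ^ q ∂μ ≤ c ^ q := fun i hi => by
    rw [← hpow (∫⁻ ω, u i ω ^ q ∂μ)]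
    exact ENNReal.rpow_le_rpow (hc i hi) hq.le
  unfold lqNorm lqSum
  simp_rw [hpow]
  rw [lintegral_finsetSum' _ fun i hi => ((hu i hi).pow_const q).aemeasurable]
  calc (∑ i ∈ s, ∫⁻ ω, u i ω ^ q ∂μ) ^ (1 / q) ≤ (∑ _i ∈ s, c ^ q) ^ (1 / q) := by
        gcongr with i hi
        exact h1 i hi
    _ = _ := by
        rw [Finset.sum_const, nsmul_eq_mul, ENNReal.mul_rpow_of_nonneg _ _ (by positivity),
          ← ENNReal.rpow_mul, mul_one_div_cancel hq.ne', ENNReal.rpow_one]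

end LqNorm

/-- The composition `π k ∘ π (k + 1) ∘ ⋯ ∘ π (k + j - 1)` of projections on coarser levels. -/
def chainMap {α : Type*} (π : ℕ → α → α) (k : ℕ) : ℕ → α → α
  | 0 => id
  | j + 1 => fun a => chainMap π k j (π (k + j) a)

section Chain

variable {α : Type*} {π : ℕ → α → α} {A : ℕ → Finset α} {F : Set α}

lemma chainMap_mem (hA : ∀ k, ∀ a ∈ A k, a ∈ F) (hπ : ∀ k, ∀ φ ∈ F, π k φ ∈ A k) (k j : ℕ) {a : α}
    (ha : a ∈ A (k + j)) : chainMap π k j a ∈ A k := by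
  induction j generalizing a with
  | zero => exact ha
  | succ j ih => exact ih (hπ _ _ (hA _ _ ha))

/-- Telescoping along the chain, each link being bounded uniformly over its finite level, so that
the right side does not depend on `a`. -/
lemma enorm_sub_chainMap_le (hA : ∀ k, ∀ a ∈ A k, a ∈ F) (hπ : ∀ k, ∀ φ ∈ F, π k φ ∈ A k) {q : ℝ}
    (hq : 0 < q) (G : α → ℝ) (k j : ℕ) {a : α} (ha : a ∈ A (k + j)) :
    ‖G a - G (chainMap π k j a)‖ₑ ≤ ∑ i ∈ Finset.range j,
      lqSum q (A (k + i + 1)) fun b => ‖G b - G (π (k + i) b)‖ₑ := by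
  induction j generalizing a with
  | zero => simp [chainMap]
  | succ j ih =>
    rw [Finset.sum_range_succ, add_comm (Finset.sum _ _)]
    calc ‖G a - G (chainMap π k (j + 1) a)‖ₑ = ‖(G a - G (π (k + j) a)) +
          (G (π (k + j) a) - G (chainMap π k j (π (k + j) a)))‖ₑ := by
          rw [sub_add_sub_cancel]; rfl
      _ ≤ _ := enorm_add_le _ _
      _ ≤ _ := add_le_add (le_lqSum hq (s := A (k + j + 1)) ha
          fun b => ‖G b - G (π (k + j) b)‖ₑ) (ih (hπ _ _ (hA _ _ ha)))

end Chain

/-! ### Pointwise properties of the empirical process -/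

section Empirical

variable {Ω 𝒳 : Type*} [MeasurableSpace Ω] {μ : Measure Ω} {X : ℕ → ℕ → Ω → 𝒳} {n : ℕ}

lemma measurable_empirical [MeasurableSpace 𝒳] (hX : ∀ t ∈ Finset.Icc 1 n, Measurable (X n t))
    {f : 𝒳 → ℝ} (hf : Measurable f) : Measurable (empirical μ X n 1 f) := by
  have : empirical μ X n 1 f = fun ω => 1 / √(n : ℝ) *
      ∑ i ∈ Finset.Icc 1 n, (f (X n i ω) - ∫ ω', f (X n i ω') ∂μ) :=
    funext fun ω => empirical_one n f ω
  rw [this]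
  exact (Finset.measurable_sum _ fun i hi => (hf.comp (hX i hi)).sub_const _).const_mul _

lemma empirical_sub {φ ψ : 𝒳 → ℝ}
    (hφ : ∀ t ∈ Finset.Icc 1 n, Integrable (fun ω => φ (X n t ω)) μ)
    (hψ : ∀ t ∈ Finset.Icc 1 n, Integrable (fun ω => ψ (X n t ω)) μ) (ω : Ω) :
    empirical μ X n 1 φ ω - empirical μ X n 1 ψ ω =
      empirical μ X n 1 (fun x => φ x - ψ x) ω := by
  rw [empirical_one, empirical_one, empirical_one, ← mul_sub, ← Finset.sum_sub_distrib]
  congr 1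
  refine Finset.sum_congr rfl fun i hi => ?_
  rw [integral_sub (hφ i hi) (hψ i hi)]
  ring

/-- Each summand loses at most `2 * ε`: once for the mean of `φ - a`, once for centring `b`. With
`n` summands and the factor `1 / √n` this is `2 * (√n * ε)`. -/
lemma enorm_empirical_sub_le {φ a b : 𝒳 → ℝ} {ε : ℝ}
    (hφ : ∀ t ∈ Finset.Icc 1 n, Integrable (fun ω => φ (X n t ω)) μ)
    (ha : ∀ t ∈ Finset.Icc 1 n, Integrable (fun ω => a (X n t ω)) μ)
    (hb : ∀ t ∈ Finset.Icc 1 n, Integrable (fun ω => b (X n t ω)) μ)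
    (hle : ∀ x, |φ x - a x| ≤ b x) (hε : ∀ t ∈ Finset.Icc 1 n, ∫ ω, b (X n t ω) ∂μ ≤ ε) (ω : Ω) :
    ‖empirical μ X n 1 φ ω - empirical μ X n 1 a ω‖ₑ ≤
      ‖empirical μ X n 1 b ω‖ₑ + ENNReal.ofReal (2 * (√n * ε)) := by
  have hn : (n : ℝ) / √n = √n := Real.div_sqrt
  have h1 : |empirical μ X n 1 φ ω - empirical μ X n 1 a ω| ≤
      empirical μ X n 1 b ω + 2 * (√n * ε) := by
    rw [empirical_sub hφ ha, empirical_one, empirical_one, abs_mul,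
      abs_of_nonneg (by positivity : (0 : ℝ) ≤ 1 / √n)]
    have h2 : |∑ i ∈ Finset.Icc 1 n, (φ (X n i ω) - a (X n i ω) -
        ∫ ω', (φ (X n i ω') - a (X n i ω')) ∂μ)| ≤
        ∑ i ∈ Finset.Icc 1 n, ((b (X n i ω) - ∫ ω', b (X n i ω') ∂μ) + 2 * ε) := by
      refine (Finset.abs_sum_le_sum_abs _ _).trans (Finset.sum_le_sum fun i hi => ?_)
      have h3 : |∫ ω', (φ (X n i ω') - a (X n i ω')) ∂μ| ≤ ∫ ω', b (X n i ω') ∂μ :=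
        (abs_integral_le_integral_abs).trans
          (integral_mono ((hφ i hi).sub (ha i hi)).abs (hb i hi) fun ω' => hle _)
      have h4 := abs_sub (φ (X n i ω) - a (X n i ω)) (∫ ω', (φ (X n i ω') - a (X n i ω')) ∂μ)
      linarith [hle (X n i ω), hε i hi]
    calc _ ≤ 1 / √n * ∑ i ∈ Finset.Icc 1 n, ((b (X n i ω) - ∫ ω', b (X n i ω') ∂μ) + 2 * ε) := by
          gcongr
      _ = 1 / √n * ∑ i ∈ Finset.Icc 1 n, (b (X n i ω) - ∫ ω', b (X n i ω') ∂μ) +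
          2 * (n / √n * ε) := by
          rw [Finset.sum_add_distrib, Finset.sum_const, Nat.card_Icc, Nat.add_sub_cancel,
            nsmul_eq_mul]
          ring
      _ = _ := by rw [hn]
  rw [Real.enorm_eq_ofReal_abs, Real.enorm_eq_ofReal_abs]
  calc _ ≤ ENNReal.ofReal (|empirical μ X n 1 b ω| + 2 * (√n * ε)) :=
        ENNReal.ofReal_le_ofReal (h1.trans (by gcongr; exact le_abs_self _))
    _ ≤ _ := ENNReal.ofReal_add_le

end Empirical

/-! ### Stochastic equicontinuity -/

/-- Projections of a related pair need not be related. For each pair of projections that occurs, one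
related pair above it is therefore fixed, which leaves finitely many related pairs to control. -/
lemma exists_representatives {α : Type*} {A : Finset α} {F : Set α} {p : α → α}
    (hp : ∀ φ ∈ F, p φ ∈ A) (r : α → α → Prop) :
    ∃ (P : Finset (α × α)) (rep : α × α → α × α), P.card ≤ A.card ^ 2 ∧
      (∀ z ∈ P, (rep z).1 ∈ F ∧ (rep z).2 ∈ F ∧ r (rep z).1 (rep z).2 ∧ p (rep z).1 = z.1 ∧
        p (rep z).2 = z.2) ∧ ∀ φ ∈ F, ∀ ψ ∈ F, r φ ψ → (p φ, p ψ) ∈ P := by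
  classical
  set P : Finset (α × α) := (A ×ˢ A).filter fun z =>
    ∃ w : α × α, w.1 ∈ F ∧ w.2 ∈ F ∧ r w.1 w.2 ∧ p w.1 = z.1 ∧ p w.2 = z.2
  have hP : ∀ z : α × α, z ∈ P →
      ∃ w : α × α, w.1 ∈ F ∧ w.2 ∈ F ∧ r w.1 w.2 ∧ p w.1 = z.1 ∧ p w.2 = z.2 := fun z hz =>
    (Finset.mem_filter.1 hz).2
  by_cases hne : Nonempty α
  · have : Nonempty (α × α) := inferInstance
    choose! rep hrep using hP
    refine ⟨P, rep, ?_, hrep, fun φ hφ ψ hψ hr => ?_⟩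
    · refine (Finset.card_filter_le _ _).trans_eq ?_
      rw [Finset.card_product, sq]
    · exact Finset.mem_filter.2 ⟨Finset.mem_product.2 ⟨hp φ hφ, hp ψ hψ⟩, (φ, ψ), hφ, hψ, hr,
        rfl, rfl⟩
  · exact ⟨∅, id, by simp, by simp, fun φ => (hne ⟨φ⟩).elim⟩

lemma lintegral_rpow_le_of_supMoment_le {Ω 𝒳 : Type*} [MeasurableSpace Ω] {μ : Measure Ω}
    {X : ℕ → ℕ → Ω → 𝒳} {p ε : ℝ} {b : 𝒳 → ℝ}
    (h : supMoment μ X p (1 / 2) b ≤ ENNReal.ofReal ε) {n t : ℕ} (ht : t ∈ Finset.Icc 1 n) :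
    ∫⁻ ω, ‖b (X n t ω)‖ₑ ^ p ∂μ ≤ ENNReal.ofReal ε ^ (2 : ℝ) := by
  have h1 : (∫⁻ ω, ‖b (X n t ω)‖ₑ ^ p ∂μ) ^ (1 / 2 : ℝ) ≤ ENNReal.ofReal ε := by
    refine le_trans ?_ h
    unfold supMoment
    exact le_trans (le_iSup₂ (f := fun t (_ : t ∈ Finset.Icc 1 n) =>
      (∫⁻ ω, ‖b (X n t ω)‖ₑ ^ p ∂μ) ^ (1 / 2 : ℝ)) t ht) (le_iSup (fun n => ⨆ t ∈ Finset.Icc 1 n,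
        (∫⁻ ω, ‖b (X n t ω)‖ₑ ^ p ∂μ) ^ (1 / 2 : ℝ)) n)
  calc _ = ((∫⁻ ω, ‖b (X n t ω)‖ₑ ^ p ∂μ) ^ (1 / 2 : ℝ)) ^ (2 : ℝ) := by
        rw [← ENNReal.rpow_mul]; norm_num
    _ ≤ _ := by gcongr

section Equicontinuity

variable {Ω 𝒳 : Type*} [MeasurableSpace Ω] [MeasurableSpace 𝒳] {μ : Measure Ω}
  {X : ℕ → ℕ → Ω → 𝒳}

variable [IsProbabilityMeasure μ]

lemma integrable_and_integral_le_of_rho_lt (hX : ∀ n, ∀ t ∈ Finset.Icc 1 n, Measurable (X n t))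
    {b : 𝒳 → ℝ} (hb : Measurable b) {ε : ℝ} (hε : 0 ≤ ε) (h : rho μ X b < ENNReal.ofReal ε)
    {n t : ℕ} (ht : t ∈ Finset.Icc 1 n) :
    Integrable (fun ω => b (X n t ω)) μ ∧ ∫ ω, b (X n t ω) ∂μ ≤ ε := by
  have hm : Measurable fun ω => b (X n t ω) := hb.comp (hX n t ht)
  have h2 : ∫⁻ ω, ‖b (X n t ω)‖ₑ ^ (2 : ℝ) ∂μ ≤ ENNReal.ofReal ε ^ (2 : ℝ) :=
    lintegral_rpow_le_of_supMoment_le h.le ht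
  refine ⟨integrable_of_lintegral_rpow_ne_top hm one_le_two (h2.trans_lt
    (ENNReal.rpow_lt_top_of_nonneg (by norm_num) ENNReal.ofReal_ne_top)).ne, ?_⟩
  have h3 : ‖∫ ω, b (X n t ω) ∂μ‖ₑ ≤ ENNReal.ofReal ε := by
    calc ‖∫ ω, b (X n t ω) ∂μ‖ₑ ≤ ∫⁻ ω, ‖b (X n t ω)‖ₑ ^ (1 : ℝ) ∂μ := by
          simpa using enorm_integral_le_lintegral_enorm fun ω => b (X n t ω)
      _ ≤ (∫⁻ ω, ‖b (X n t ω)‖ₑ ^ (2 : ℝ) ∂μ) ^ (1 / 2 : ℝ) :=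
          lintegral_rpow_le_rpow_lintegral_rpow hm.enorm one_pos one_le_two
      _ ≤ (ENNReal.ofReal ε ^ (2 : ℝ)) ^ (1 / 2 : ℝ) := by gcongr
      _ = ENNReal.ofReal ε := by rw [← ENNReal.rpow_mul]; norm_num
  rw [Real.enorm_eq_ofReal_abs, ENNReal.ofReal_le_ofReal_iff hε] at h3
  exact (le_abs_self _).trans h3

/-- Lower moments follow from the one of order `Q(2+γ)/2` by Jensen; then `δ ≤ 1` and `i ≥ 2` allow
the exponent to be lowered to `2 + γ`. This is the moment condition for `v = δ²`. -/
lemma lintegral_rpow_le_of_dist_lt (hX : ∀ n, ∀ t ∈ Finset.Icc 1 n, Measurable (X n t)) {Q : ℕ}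
    {γ δ : ℝ} (hγ : 0 < γ) (hδ1 : δ ≤ 1) {φ ψ : 𝒳 → ℝ} (hφ : Measurable φ)
    (hψ : Measurable ψ) (h : dist μ X Q γ φ ψ < ENNReal.ofReal δ) {i n t : ℕ}
    (hi : i ∈ Finset.Icc 2 Q) (ht : t ∈ Finset.Icc 1 n) :
    ∫⁻ ω, ‖φ (X n t ω) - ψ (X n t ω)‖ₑ ^ (i * ((2 + γ) / 2)) ∂μ ≤
      (ENNReal.ofReal δ ^ (2 : ℝ)) ^ ((2 + γ) / 2) := by
  obtain ⟨hi2, hiQ⟩ := Finset.mem_Icc.1 hi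
  have hγ2 : 0 < 2 + γ := by linarith
  have hi2' : (2 : ℝ) ≤ i := by exact_mod_cast hi2
  have hiQ' : (i : ℝ) ≤ Q := by exact_mod_cast hiQ
  have hQ0 : (0 : ℝ) < Q := by linarith
  set S : ℝ := Q * ((2 + γ) / 2) with hS
  set s : ℝ := i * ((2 + γ) / 2) with hs
  have hs0 : 0 < s := by positivity
  have hS0 : 0 < S := by positivity
  have hsS : s ≤ S := by rw [hs, hS]; gcongr
  have hm : Measurable fun ω => φ (X n t ω) - ψ (X n t ω) :=
    (hφ.comp (hX n t ht)).sub (hψ.comp (hX n t ht))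
  have hr : 1 / (Q : ℝ) * (2 / (2 + γ)) = 1 / S := by rw [hS]; field_simp
  have h1 : (∫⁻ ω, ‖φ (X n t ω) - ψ (X n t ω)‖ₑ ^ S ∂μ) ^ (1 / S) ≤ ENNReal.ofReal δ := by
    refine le_trans ?_ h.le
    unfold dist supMoment
    rw [hr]
    exact le_trans (le_iSup₂ (f := fun t (_ : t ∈ Finset.Icc 1 n) =>
      (∫⁻ ω, ‖φ (X n t ω) - ψ (X n t ω)‖ₑ ^ S ∂μ) ^ (1 / S)) t ht)
      (le_iSup (fun n => ⨆ t ∈ Finset.Icc 1 n,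
        (∫⁻ ω, ‖φ (X n t ω) - ψ (X n t ω)‖ₑ ^ S ∂μ) ^ (1 / S)) n)
  calc ∫⁻ ω, ‖φ (X n t ω) - ψ (X n t ω)‖ₑ ^ s ∂μ
      ≤ (∫⁻ ω, ‖φ (X n t ω) - ψ (X n t ω)‖ₑ ^ S ∂μ) ^ (s / S) :=
        lintegral_rpow_le_rpow_lintegral_rpow hm.enorm hs0 hsS
    _ = ((∫⁻ ω, ‖φ (X n t ω) - ψ (X n t ω)‖ₑ ^ S ∂μ) ^ (1 / S)) ^ s := by
        rw [← ENNReal.rpow_mul, one_div_mul_eq_div]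
    _ ≤ ENNReal.ofReal δ ^ s := by gcongr
    _ ≤ ENNReal.ofReal δ ^ (2 * ((2 + γ) / 2)) := by
        refine ENNReal.rpow_le_rpow_of_exponent_ge (ENNReal.ofReal_le_one.2 hδ1) ?_
        rw [hs]; gcongr
    _ = _ := ENNReal.rpow_mul _ _ _

/-- The bound that chaining between the levels `k₀` and `k₀ + J` gives for the modulus of continuity
of the empirical process. -/
lemma outerExpectation_rpow_le (hX : ∀ n, ∀ t ∈ Finset.Icc 1 n, Measurable (X n t))
    {F : Set (𝒳 → ℝ)} (hF : ∀ φ ∈ F, Measurable φ)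
    (hFint : ∀ φ ∈ F, ∀ n, ∀ t ∈ Finset.Icc 1 n, Integrable (fun ω => φ (X n t ω)) μ)
    {Q : ℕ} (hQ : 2 ≤ Q) {γ : ℝ} (hγ : 0 < γ) {C : ℝ≥0∞}
    (hC : ∀ (n : ℕ) (f : 𝒳 → ℝ), Measurable f → ∀ v : ℝ≥0∞, v ≠ ⊤ → 1 ≤ n * v →
      (∀ i ∈ Finset.Icc 2 Q, ∀ t ∈ Finset.Icc 1 n,
        ∫⁻ ω, ‖f (X n t ω)‖ₑ ^ (i * ((2 + γ) / 2)) ∂μ ≤ v ^ ((2 + γ) / 2)) →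
      lqNorm μ Q (fun ω => ‖empirical μ X n 1 f ω‖ₑ) ≤ C * v ^ (1 / 2 : ℝ))
    {N : ℕ → ℕ} {A B : ℕ → Finset (𝒳 → ℝ)}
    (hAB : ∀ k, IsBracketing (rho μ X) F ((1 / 2 : ℝ) ^ k) (N k) (A k) (B k))
    (hmom : ∀ k, ∀ i ∈ Finset.Icc 2 Q, ∀ b ∈ B k,
      supMoment μ X (i * ((2 + γ) / 2)) (1 / 2) b ≤ ENNReal.ofReal ((1 / 2 : ℝ) ^ k))
    {n k₀ J : ℕ}
    (hlevel : ∀ k ≤ k₀ + J, 1 ≤ n * ENNReal.ofReal ((1 / 2 : ℝ) ^ k) ^ (4 / (2 + γ)))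
    {δ : ℝ} (hδ1 : δ ≤ 1) (hnδ : 1 ≤ n * ENNReal.ofReal δ ^ (2 : ℝ)) :
    outerExpectation μ (fun ω => ⨆ (φ ∈ F) (ψ ∈ F) (_ : dist μ X Q γ φ ψ < ENNReal.ofReal δ),
      ‖empirical μ X n 1 φ ω - empirical μ X n 1 ψ ω‖ₑ ^ Q) ^ (1 / (Q : ℝ)) ≤
    4 * (ENNReal.ofReal (2 * (√n * (1 / 2 : ℝ) ^ (k₀ + J))) +
      3 * C * ∑' k, ENNReal.ofReal (((1 / 2 : ℝ) ^ (k + k₀)) ^ (1 - γ / (2 + γ))) *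
        (N (k + k₀) : ℝ≥0∞) ^ (1 / (Q : ℝ))) +
      ((N k₀ ^ 2 : ℕ) : ℝ≥0∞) ^ (1 / (Q : ℝ)) * (C * ENNReal.ofReal δ) := by
  have hγ2 : 0 < 2 + γ := by linarith
  have hQ0 : (0 : ℝ) < Q := by exact_mod_cast (by omega : 0 < Q)
  have hQ1 : (1 : ℝ) ≤ Q := by exact_mod_cast (by omega : 1 ≤ Q)
  set ε : ℕ → ℝ := fun k => (1 / 2 : ℝ) ^ k with hε
  have hε0 : ∀ k, 0 < ε k := fun k => by positivity
  set w : ℕ → ℝ≥0∞ := fun k => ENNReal.ofReal (ε k ^ (1 - γ / (2 + γ))) with hw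
  have hAF : ∀ k, ∀ a ∈ A k, a ∈ F := fun k => (hAB k).2.2.1
  have hproj : ∀ k, ∀ φ ∈ F, ∃ a b : 𝒳 → ℝ, a ∈ A k ∧ b ∈ B k ∧ ∀ x, |φ x - a x| ≤ b x :=
    fun k φ hφ => by
      obtain ⟨a, ha, b, hb, hab⟩ := (hAB k).2.2.2.2 φ hφ
      exact ⟨a, b, ha, hb, hab⟩
  choose! π β hπ hβ hle using hproj
  set G : (𝒳 → ℝ) → Ω → ℝ := empirical μ X n 1 with hG
  have hGm : ∀ {f : 𝒳 → ℝ}, Measurable f → Measurable (G f) := fun hf =>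
    measurable_empirical (hX n) hf
  have hdiff : ∀ φ ∈ F, ∀ ψ ∈ F, ∀ ω, G φ ω - G ψ ω = G (fun x => φ x - ψ x) ω :=
    fun φ hφ ψ hψ ω => empirical_sub (hFint φ hφ n) (hFint ψ hψ n) ω
  -- The choice `v = ε_k^(4/(2+γ))` makes `v^((2+γ)/2) = ε_k²`, the available moment bound, and
  -- `v^(1/2) = w k`.
  have hsmall : ∀ k ≤ k₀ + J, ∀ f : 𝒳 → ℝ, Measurable f → ∀ b ∈ B k, (∀ x, |f x| ≤ |b x|) →
      lqNorm μ Q (fun ω => ‖G f ω‖ₑ) ≤ C * w k := by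
    intro k hk f hf b hb hfb
    have h1 := hC n f hf (ENNReal.ofReal (ε k) ^ (4 / (2 + γ)))
      (ENNReal.rpow_ne_top_of_nonneg (by positivity) ENNReal.ofReal_ne_top) (hlevel k hk) ?_
    · refine h1.trans_eq ?_
      rw [hw, ← ENNReal.rpow_mul, ENNReal.ofReal_rpow_of_pos (hε0 k)]
      congr 3
      field_simp
      ring
    · intro i hi t ht
      rw [← ENNReal.rpow_mul]
      have e1 : 4 / (2 + γ) * ((2 + γ) / 2) = 2 := by field_simp; norm_num
      rw [e1]
      refine le_trans (lintegral_mono fun ω => ?_)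
        (lintegral_rpow_le_of_supMoment_le (hmom k i hi b hb) ht)
      gcongr
      rw [Real.enorm_eq_ofReal_abs, Real.enorm_eq_ofReal_abs]
      exact ENNReal.ofReal_le_ofReal (hfb _)
  set c : ℝ≥0∞ := ENNReal.ofReal (2 * (√n * ε (k₀ + J))) with hc
  set fin : Ω → ℝ≥0∞ := fun ω => lqSum Q (B (k₀ + J)) fun b => ‖G b ω‖ₑ with hfin
  set link : ℕ → Ω → ℝ≥0∞ := fun i ω =>
    lqSum Q (A (k₀ + i + 1)) fun a => ‖G a ω - G (π (k₀ + i) a) ω‖ₑ with hlink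
  have hBm : ∀ k, ∀ b ∈ B k, Measurable b := fun k b hb => ((hAB k).2.2.2.1 b hb).1
  have hpF : ∀ k, ∀ φ ∈ F, π k φ ∈ F := fun k φ hφ => hAF k _ (hπ k φ hφ)
  have hfin_m : Measurable fin := measurable_lqSum fun b hb => (hGm (hBm _ b hb)).enorm
  have hlink_m : ∀ i, Measurable (link i) := fun i => measurable_lqSum fun a ha =>
    ((hGm (hF a (hAF _ a ha))).sub (hGm (hF _ (hpF _ a (hAF _ a ha))))).enorm
  set T : Ω → ℝ≥0∞ := fun ω => fin ω + (c + ∑ i ∈ Finset.range J, link i ω) with hT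
  have hsum_m : Measurable fun ω => ∑ i ∈ Finset.range J, link i ω :=
    Finset.measurable_sum _ fun i _ => hlink_m i
  have hT_m : Measurable T := hfin_m.add (measurable_const.add hsum_m)
  -- the chain approximates every element of the class
  set p : (𝒳 → ℝ) → (𝒳 → ℝ) := chainMap π k₀ (J + 1) with hp
  have hpA : ∀ φ ∈ F, p φ ∈ A k₀ := fun φ hφ => chainMap_mem hAF hπ k₀ J (hπ _ φ hφ)
  have happ : ∀ φ ∈ F, ∀ ω, ‖G φ ω - G (p φ) ω‖ₑ ≤ T ω := by
    intro φ hφ ω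
    have hb := hβ (k₀ + J) φ hφ
    have hbρ := (hAB (k₀ + J)).2.2.2.1 _ hb
    have hbi := fun t (ht : t ∈ Finset.Icc 1 n) =>
      integrable_and_integral_le_of_rho_lt hX hbρ.1 (hε0 (k₀ + J)).le hbρ.2 ht
    have h1 := enorm_empirical_sub_le (hFint φ hφ n) (hFint _ (hpF (k₀ + J) φ hφ) n)
      (fun t ht => (hbi t ht).1) (hle (k₀ + J) φ hφ) (fun t ht => (hbi t ht).2) ω
    have h2 := enorm_sub_chainMap_le hAF hπ hQ0 (fun f => G f ω) k₀ J (hπ (k₀ + J) φ hφ)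
    calc ‖G φ ω - G (p φ) ω‖ₑ = ‖(G φ ω - G (π (k₀ + J) φ) ω) +
          (G (π (k₀ + J) φ) ω - G (chainMap π k₀ J (π (k₀ + J) φ)) ω)‖ₑ := by
          rw [sub_add_sub_cancel]; rfl
      _ ≤ _ := enorm_add_le _ _
      _ ≤ (‖G (β (k₀ + J) φ) ω‖ₑ + c) + ∑ i ∈ Finset.range J, link i ω := add_le_add h1 h2
      _ ≤ _ := by
          rw [add_assoc]
          exact add_le_add_left (le_lqSum hQ0 hb fun b => ‖G b ω‖ₑ) _
  have hTnorm : lqNorm μ Q T ≤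
      c + 3 * C * ∑' k, w (k + k₀) * (N (k + k₀) : ℝ≥0∞) ^ (1 / (Q : ℝ)) := by
    set u : ℕ → ℝ≥0∞ := fun k => w (k + k₀) * (N (k + k₀) : ℝ≥0∞) ^ (1 / (Q : ℝ)) with hu
    have b1 : lqNorm μ Q fin ≤ C * u J := by
      refine (lqNorm_lqSum_le hQ0 (fun b hb => (hGm (hBm _ b hb)).enorm) (c := C * w (k₀ + J))
        fun b hb => hsmall _ le_rfl b (hBm _ b hb) b hb fun _ => le_rfl).trans_eq ?_
      rw [(hAB (k₀ + J)).2.1, hu]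
      simp only [add_comm J k₀]
      ring
    have b2 : ∀ i ∈ Finset.range J, lqNorm μ Q (link i) ≤ 2 * C * u (i + 1) := by
      intro i hi
      have hiJ := Finset.mem_range.1 hi
      refine (lqNorm_lqSum_le hQ0 (c := C * w (k₀ + i)) (fun a ha =>
        ((hGm (hF a (hAF _ a ha))).sub (hGm (hF _ (hpF _ a (hAF _ a ha))))).enorm)
        fun a ha => ?_).trans ?_
      · have haF := hAF _ a ha
        change lqNorm μ Q (fun ω => ‖G a ω - G (π (k₀ + i) a) ω‖ₑ) ≤ _
        simp_rw [hdiff a haF _ (hpF (k₀ + i) a haF)]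
        exact hsmall (k₀ + i) (by omega) _ ((hF a haF).sub (hF _ (hpF _ a haF))) _
          (hβ (k₀ + i) a haF) fun x => (hle (k₀ + i) a haF x).trans (le_abs_self _)
      · rw [(hAB (k₀ + i + 1)).1]
        -- A link has the size of its coarser level but the cardinality of its finer one; halving
        -- `ε` changes `w` by at most a factor 2.
        have hw2 : w (k₀ + i) ≤ 2 * w (k₀ + i + 1) := by
          have hκ : 1 - γ / (2 + γ) = 2 / (2 + γ) := by field_simp; ring
          simp only [hw, hκ]
          rw [← ENNReal.ofReal_ofNat 2, ← ENNReal.ofReal_mul (by norm_num)]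
          refine ENNReal.ofReal_le_ofReal ?_
          have e2 : ε (k₀ + i) = 2 * ε (k₀ + i + 1) := by simp only [hε]; rw [pow_succ]; ring
          rw [e2, Real.mul_rpow (by norm_num) (hε0 _).le]
          gcongr
          calc (2 : ℝ) ^ (2 / (2 + γ)) ≤ 2 ^ (1 : ℝ) :=
                Real.rpow_le_rpow_of_exponent_le (by norm_num)
                  ((div_le_one hγ2).2 (by linarith))
            _ = 2 := Real.rpow_one 2
        have e3 : i + 1 + k₀ = k₀ + i + 1 := by omega
        simp only [hu, e3]
        calc _ ≤ (N (k₀ + i + 1) : ℝ≥0∞) ^ (1 / (Q : ℝ)) * (C * (2 * w (k₀ + i + 1))) := by gcongr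
          _ = _ := by ring
    have b3 : ∑ i ∈ Finset.range J, u (i + 1) ≤ ∑' k, u k :=
      (ENNReal.sum_le_tsum _).trans
        (ENNReal.tsum_comp_le_tsum_of_injective (add_left_injective 1) u)
    calc lqNorm μ Q T ≤ lqNorm μ Q fin + (lqNorm μ Q (fun _ => c) +
          lqNorm μ Q fun ω => ∑ i ∈ Finset.range J, link i ω) :=
          (lqNorm_add_le hQ1 hfin_m (measurable_const.add hsum_m)).trans
            (add_le_add_right (lqNorm_add_le hQ1 measurable_const hsum_m) _)
      _ ≤ C * ∑' k, u k + (c + 2 * C * ∑' k, u k) := by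
          refine add_le_add (b1.trans ?_) (add_le_add (lqNorm_const hQ0 c).le ?_)
          · gcongr
            exact ENNReal.le_tsum J
          · refine (lqNorm_sum_le hQ1 _ hlink_m).trans ((Finset.sum_le_sum b2).trans ?_)
            rw [← Finset.mul_sum]
            gcongr
      _ = _ := by ring
  -- pairs of elements are compared through representatives of their coarsest approximations
  obtain ⟨P, rep, hPcard, hrep, hPmem⟩ := exists_representatives hpA
    fun φ ψ => dist μ X Q γ φ ψ < ENNReal.ofReal δ
  set R : Ω → ℝ≥0∞ := fun ω => lqSum Q P fun z => ‖G (rep z).1 ω - G (rep z).2 ω‖ₑ with hR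
  have hRu : ∀ z ∈ P, Measurable fun ω => ‖G (rep z).1 ω - G (rep z).2 ω‖ₑ := fun z hz =>
    ((hGm (hF _ (hrep z hz).1)).sub (hGm (hF _ (hrep z hz).2.1))).enorm
  have hR_m : Measurable R := measurable_lqSum hRu
  have hRnorm : lqNorm μ Q R ≤ ((N k₀ ^ 2 : ℕ) : ℝ≥0∞) ^ (1 / (Q : ℝ)) *
      (C * ENNReal.ofReal δ) := by
    refine (lqNorm_lqSum_le hQ0 (c := C * ENNReal.ofReal δ) hRu fun z hz => ?_).trans ?_
    · obtain ⟨h1, h2, h3, -, -⟩ := hrep z hz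
      simp_rw [hdiff _ h1 _ h2]
      refine (hC n _ ((hF _ h1).sub (hF _ h2)) (ENNReal.ofReal δ ^ (2 : ℝ))
        (ENNReal.rpow_ne_top_of_nonneg (by norm_num) ENNReal.ofReal_ne_top) hnδ
        fun i hi t ht => lintegral_rpow_le_of_dist_lt hX hγ hδ1 (hF _ h1) (hF _ h2) h3 hi
          ht).trans_eq ?_
      rw [← ENNReal.rpow_mul]
      norm_num
    · rw [(hAB k₀).1] at hPcard
      gcongr
  have hpair : ∀ ω, ∀ φ ∈ F, ∀ ψ ∈ F, dist μ X Q γ φ ψ < ENNReal.ofReal δ →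
      ‖G φ ω - G ψ ω‖ₑ ≤ 4 * T ω + R ω := by
    intro ω φ hφ ψ hψ hd
    have hz := hPmem φ hφ ψ hψ hd
    obtain ⟨h1, h2, -, h4, h5⟩ := hrep _ hz
    set φ' := (rep (p φ, p ψ)).1
    set ψ' := (rep (p φ, p ψ)).2
    have t1 := happ φ hφ ω
    have t2 := happ ψ hψ ω
    have t3 := happ φ' h1 ω
    have t4 := happ ψ' h2 ω
    rw [h4] at t3
    rw [h5] at t4
    dsimp only at t3 t4
    rw [← enorm_neg, neg_sub] at t2 t3
    have t5 : ‖G φ' ω - G ψ' ω‖ₑ ≤ R ω :=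
      le_lqSum hQ0 hz fun z => ‖G (rep z).1 ω - G (rep z).2 ω‖ₑ
    -- `φ` and `φ'` share the projection `p φ`, and `ψ` and `ψ'` share `p ψ`: four approximation
    -- errors and one comparison of representatives.
    calc ‖G φ ω - G ψ ω‖ₑ = ‖(G φ ω - G (p φ) ω) + (G (p φ) ω - G φ' ω) +
          (G φ' ω - G ψ' ω) + (G ψ' ω - G (p ψ) ω) + (G (p ψ) ω - G ψ ω)‖ₑ := by
          congr 1; ring
      _ ≤ ‖G φ ω - G (p φ) ω‖ₑ + ‖G (p φ) ω - G φ' ω‖ₑ + ‖G φ' ω - G ψ' ω‖ₑ +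
          ‖G ψ' ω - G (p ψ) ω‖ₑ + ‖G (p ψ) ω - G ψ ω‖ₑ :=
          (enorm_add_le _ _).trans (add_le_add_left ((enorm_add_le _ _).trans
            (add_le_add_left ((enorm_add_le _ _).trans (add_le_add_left (enorm_add_le _ _) _))
              _)) _)
      _ ≤ T ω + T ω + R ω + T ω + T ω := by gcongr
      _ = _ := by ring
  calc _ ≤ lqNorm μ Q fun ω => 4 * T ω + R ω := by
        unfold lqNorm
        refine ENNReal.rpow_le_rpow ?_ (by positivity)
        unfold outerExpectation
        refine iInf_le_of_le (fun ω => (4 * T ω + R ω) ^ (Q : ℝ)) (iInf₂_le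
          (((hT_m.const_mul 4).add hR_m).pow_const _) fun ω => ?_)
        refine iSup₂_le fun φ hφ => iSup₂_le fun ψ hψ => iSup_le fun hd => ?_
        dsimp only
        rw [ENNReal.rpow_natCast]
        gcongr
        exact hpair ω φ hφ ψ hψ hd
    _ ≤ lqNorm μ Q (fun ω => 4 * T ω) + lqNorm μ Q R :=
        lqNorm_add_le hQ1 (hT_m.const_mul 4) hR_m
    _ ≤ _ := by
        rw [lqNorm_const_mul hQ0 4 hT_m]
        gcongr

end Equicontinuity

/-- The level is given by `2^K ≤ n^((2+γ)/4) < 2^(K+1)`: the lower bound keeps `n v ≥ 1` down the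
chain, the upper one makes the bias of the last bracket vanish. -/
lemma exists_chaining_level {γ : ℝ} (hγ : 0 < γ) {n : ℕ} (hn : 1 ≤ n) :
    ∃ K : ℕ, (∀ k ≤ K, 1 ≤ (n : ℝ≥0∞) * ENNReal.ofReal ((1 / 2 : ℝ) ^ k) ^ (4 / (2 + γ))) ∧
      √n * (1 / 2 : ℝ) ^ K ≤ 2 * (n : ℝ) ^ (-(γ / 4)) ∧
      (n : ℝ) ^ ((2 + γ) / 4) < 2 ^ (K + 1) := by
  have hγ2 : 0 < 2 + γ := by linarith
  have hn1 : (1 : ℝ) ≤ n := by exact_mod_cast hn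
  have hn0 : (0 : ℝ) < n := by linarith
  set x : ℝ := (n : ℝ) ^ ((2 + γ) / 4) with hx
  have hx1 : 1 ≤ x := Real.one_le_rpow hn1 (by positivity)
  have hx0 : 0 < x := by linarith
  obtain ⟨K, hK1, hK2⟩ := exists_nat_pow_near hx1 (one_lt_two (α := ℝ))
  refine ⟨K, fun k hk => ?_, ?_, hK2⟩
  · have h1 : x⁻¹ ≤ (1 / 2 : ℝ) ^ k := by
      rw [one_div, inv_pow]
      exact inv_anti₀ (by positivity) ((pow_le_pow_right₀ one_le_two hk).trans hK1)
    have h2 : (n : ℝ)⁻¹ ≤ ((1 / 2 : ℝ) ^ k) ^ (4 / (2 + γ)) := by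
      calc (n : ℝ)⁻¹ = (x⁻¹) ^ (4 / (2 + γ)) := by
            rw [Real.inv_rpow hx0.le, hx, ← Real.rpow_mul hn0.le]
            have : (2 + γ) / 4 * (4 / (2 + γ)) = 1 := by field_simp
            rw [this, Real.rpow_one]
        _ ≤ _ := Real.rpow_le_rpow (inv_nonneg.2 hx0.le) h1 (by positivity)
    rw [ENNReal.ofReal_rpow_of_pos (by positivity), ← ENNReal.ofReal_natCast,
      ← ENNReal.ofReal_mul hn0.le, ENNReal.one_le_ofReal]
    calc (1 : ℝ) = n * (n : ℝ)⁻¹ := (mul_inv_cancel₀ hn0.ne').symm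
      _ ≤ _ := by gcongr
  · have h1 : (1 / 2 : ℝ) ^ K ≤ 2 * x⁻¹ := by
      have h2 : ((2 : ℝ) ^ (K + 1))⁻¹ ≤ x⁻¹ := inv_anti₀ hx0 hK2.le
      calc (1 / 2 : ℝ) ^ K = 2 * ((2 : ℝ) ^ (K + 1))⁻¹ := by
            rw [one_div, inv_pow, pow_succ, mul_inv]; ring
        _ ≤ _ := by gcongr
    calc √n * (1 / 2 : ℝ) ^ K ≤ √n * (2 * x⁻¹) := by gcongr
      _ = 2 * (√n * x⁻¹) := by ring
      _ = _ := by
        rw [Real.sqrt_eq_rpow, hx, ← Real.rpow_neg hn0.le, ← Real.rpow_add hn0]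
        congr 2
        ring

end EmpProc

end

/-! ### The limits in the sample size, the radius and the coarsest level. -/

theorem theorem1 {Ω 𝒳 : Type*} [MeasurableSpace Ω] [MeasurableSpace 𝒳]
    (μ : Measure Ω) [IsProbabilityMeasure μ]
    (X : ℕ → ℕ → Ω → 𝒳) (hX : ∀ n, ∀ t ∈ Finset.Icc 1 n, Measurable (X n t))
    (F : Set (𝒳 → ℝ)) (hF : ∀ φ ∈ F, Measurable φ)
    -- the expectations in the definition of the empirical process exist
    (hFint : ∀ φ ∈ F, ∀ n, ∀ t ∈ Finset.Icc 1 n, Integrable (fun ω => φ (X n t ω)) μ)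
    (Q : ℕ) (hQ : 2 ≤ Q) (hQeven : Even Q) (γ : ℝ) (hγ : 0 < γ)
    (hmix : EmpProc.StronglyMixing μ X)
    (hsum : ∑' t : ℕ, ((t + 1 : ℕ) : ℝ≥0∞) ^ (Q - 2) *
        EmpProc.alpha μ X (t + 1) ^ (γ / (2 + γ)) < ⊤)
    (hentropy : ∫⁻ x in Set.Ioc (0 : ℝ) 1, ENNReal.ofReal (x ^ (-(γ / (2 + γ)))) *
        (EmpProc.bracketingNumber (EmpProc.rho μ X) F x : ℝ≥0∞) ^ (1 / (Q : ℝ)) < ⊤)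
    (hbound : ∀ ε : ℝ, 0 < ε → ∃ (N : ℕ) (A B : Finset (𝒳 → ℝ)),
        (N : ℕ∞) = EmpProc.bracketingNumber (EmpProc.rho μ X) F ε ∧
        EmpProc.IsBracketing (EmpProc.rho μ X) F ε N A B ∧
        ∀ i ∈ Finset.Icc 2 Q, ∀ b ∈ B,
          EmpProc.supMoment μ X (i * ((2 + γ) / 2)) (1 / 2) b ≤ ENNReal.ofReal ε) :
    Tendsto
      (fun δ : ℝ => limsup
        (fun n : ℕ => EmpProc.outerExpectation μ
          (fun ω => ⨆ (φ ∈ F) (ψ ∈ F) (_ : EmpProc.dist μ X Q γ φ ψ < ENNReal.ofReal δ),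
            ‖EmpProc.empirical μ X n 1 φ ω - EmpProc.empirical μ X n 1 ψ ω‖ₑ ^ Q)
          ^ (1 / (Q : ℝ)))
        atTop)
      (𝓝[>] 0) (𝓝 0) := by
  have hγ2 : 0 < 2 + γ := by linarith
  have hQ0 : (0 : ℝ) < Q := by exact_mod_cast (by omega : 0 < Q)
  obtain ⟨C, hCtop, hC⟩ := EmpProc.exists_lintegral_empirical_le hX hQ hQeven hγ hsum
  choose N A B hN hAB hmom using fun k : ℕ => hbound ((1 / 2 : ℝ) ^ k) (by positivity)
  set u : ℕ → ℝ≥0∞ := fun k => ENNReal.ofReal (((1 / 2 : ℝ) ^ k) ^ (1 - γ / (2 + γ))) *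
    (N k : ℝ≥0∞) ^ (1 / (Q : ℝ)) with hu
  have hu_sum : ∑' k, u k ≠ ⊤ := by
    have h := EmpProc.tsum_dyadic_bracketingNumber_ne_top (by positivity) (by positivity) hentropy
    simp_rw [← hN] at h
    simpa [hu] using h
  have htail : Tendsto (fun k₀ => 4 * (3 * C * ∑' k, u (k + k₀))) atTop (𝓝 0) := by
    have h := ENNReal.tendsto_sum_nat_add u hu_sum
    have h1 := ENNReal.Tendsto.const_mul (a := 4) (ENNReal.Tendsto.const_mul (a := 3 * C) h
      (Or.inr (ENNReal.mul_ne_top (by simp) hCtop))) (Or.inr (by simp))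
    simpa using h1
  have hlim : ∀ (k₀ : ℕ) (δ : ℝ), 0 < δ → δ ≤ 1 → limsup
      (fun n : ℕ => EmpProc.outerExpectation μ
        (fun ω => ⨆ (φ ∈ F) (ψ ∈ F) (_ : EmpProc.dist μ X Q γ φ ψ < ENNReal.ofReal δ),
          ‖EmpProc.empirical μ X n 1 φ ω - EmpProc.empirical μ X n 1 ψ ω‖ₑ ^ Q)
        ^ (1 / (Q : ℝ))) atTop ≤ 4 * (3 * C * ∑' k, u (k + k₀)) +
          ((N k₀ ^ 2 : ℕ) : ℝ≥0∞) ^ (1 / (Q : ℝ)) * (C * ENNReal.ofReal δ) := by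
    intro k₀ δ hδ hδ1
    set D : ℝ≥0∞ := ((N k₀ ^ 2 : ℕ) : ℝ≥0∞) ^ (1 / (Q : ℝ)) * (C * ENNReal.ofReal δ)
    set c : ℕ → ℝ≥0∞ := fun n => ENNReal.ofReal (2 * (2 * (n : ℝ) ^ (-(γ / 4)))) with hc
    have hc0 : Tendsto c atTop (𝓝 0) := by
      have h1 : Tendsto (fun n : ℕ => (n : ℝ) ^ (-(γ / 4))) atTop (𝓝 0) :=
        (tendsto_rpow_neg_atTop (by positivity)).comp tendsto_natCast_atTop_atTop
      have h2 := ENNReal.tendsto_ofReal ((h1.const_mul 2).const_mul 2)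
      rw [mul_zero, mul_zero, ENNReal.ofReal_zero] at h2
      exact h2
    have hg : Tendsto (fun n => 4 * (c n + 3 * C * ∑' k, u (k + k₀)) + D) atTop
        (𝓝 (4 * (3 * C * ∑' k, u (k + k₀)) + D)) := by
      have h1 := (ENNReal.Tendsto.const_mul (a := 4)
        (hc0.add_const (3 * C * ∑' k, u (k + k₀))) (Or.inr (by simp))).add_const D
      simpa using h1
    refine le_trans (limsup_le_limsup ?_) hg.limsup_eq.le
    have hx : Tendsto (fun n : ℕ => (n : ℝ) ^ ((2 + γ) / 4)) atTop atTop :=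
      (tendsto_rpow_atTop (by positivity)).comp tendsto_natCast_atTop_atTop
    -- The second condition puts the final level `K` above `k₀`; the third is `n δ² ≥ 1`.
    filter_upwards [eventually_ge_atTop 1, hx.eventually_ge_atTop ((2 : ℝ) ^ k₀),
      tendsto_natCast_atTop_atTop.eventually_ge_atTop ((δ ^ 2)⁻¹)] with n hn1 hnk hnδ
    obtain ⟨K, hK1, hK2, hK3⟩ := EmpProc.exists_chaining_level hγ hn1
    have hkK : k₀ ≤ K := by
      have : (2 : ℝ) ^ k₀ < 2 ^ (K + 1) := hnk.trans_lt hK3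
      exact Nat.lt_succ_iff.1 ((pow_lt_pow_iff_right₀ one_lt_two).1 this)
    obtain ⟨J, rfl⟩ := Nat.exists_eq_add_of_le hkK
    refine (EmpProc.outerExpectation_rpow_le hX hF hFint hQ hγ hC hAB hmom hK1 hδ1 ?_).trans ?_
    · rw [ENNReal.ofReal_rpow_of_pos hδ, ← ENNReal.ofReal_natCast,
        ← ENNReal.ofReal_mul (Nat.cast_nonneg n), ENNReal.one_le_ofReal, Real.rpow_two]
      calc (1 : ℝ) = (δ ^ 2)⁻¹ * δ ^ 2 := (inv_mul_cancel₀ (by positivity)).symm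
        _ ≤ _ := by gcongr
    · gcongr
      exact ENNReal.ofReal_le_ofReal (mul_le_mul_of_nonneg_left hK2 zero_le_two)
  rw [ENNReal.tendsto_nhds_zero]
  intro η hη
  -- `k₀` is fixed before `δ`, so that `N k₀` is a constant which a small `δ` outweighs.
  obtain ⟨k₀, hk₀⟩ := ((ENNReal.tendsto_nhds_zero.1 htail) (η / 2) (ENNReal.half_pos hη.ne')).exists
  have hδ : Tendsto (fun δ : ℝ => ((N k₀ ^ 2 : ℕ) : ℝ≥0∞) ^ (1 / (Q : ℝ)) *
      (C * ENNReal.ofReal δ)) (𝓝[>] 0) (𝓝 0) := by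
    have h1 : Tendsto (fun δ : ℝ => ENNReal.ofReal δ) (𝓝[>] 0) (𝓝 0) := by
      simpa using (ENNReal.continuous_ofReal.tendsto 0).mono_left nhdsWithin_le_nhds
    have h2 := ENNReal.Tendsto.const_mul (a := ((N k₀ ^ 2 : ℕ) : ℝ≥0∞) ^ (1 / (Q : ℝ)))
      (ENNReal.Tendsto.const_mul (a := C) h1 (Or.inr hCtop))
      (Or.inr (ENNReal.rpow_ne_top_of_nonneg (by positivity) (ENNReal.natCast_ne_top _)))
    simpa using h2
  filter_upwards [ENNReal.tendsto_nhds_zero.1 hδ (η / 2) (ENNReal.half_pos hη.ne'),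
    Ioc_mem_nhdsGT (zero_lt_one (α := ℝ))] with δ h1 h2
  calc _ ≤ _ := hlim k₀ δ h2.1 h2.2
    _ ≤ η / 2 + η / 2 := add_le_add hk₀ h1
    _ = η := ENNReal.add_halves η
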